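/- Let the scalar field be $\mathbb{K}=\mathbb{R}$ or $\mathbb{C}$, and let $c_{00}$ be the space of finitely supported scalar sequences $x=(x_n)_{n=1}^\infty$; for $E\subseteq\mathbb{N}$ let $Ex$ be the restriction of $x$ to $E$ (zero off $E$). For $x\in c_{00}$ put $\|x\|_0=\max_n|x_n|$, \[ \|x\|_{m+1}=\max\Big\{\|x\|_m,\ \tfrac12\sup\sum_{j=1}^k\|E_jx\|_m\Big\},\qquad m\ge 0, \] the supremum being taken over all $k\in\mathbb{N}$ and all finite non-empty sets $E_1<E_2<\dots<E_k$ of positive integers with $k\le\min E_1$, and let $\|x\|_{\mathcal{T}}=\lim_m\|x\|_m$. For $0<r<\infty$ the $r$-convexified Tsirelson space $\mathcal{T}^{(r)}$ is the completion of $c_{00}$ under the norm (quasi-norm if $r<1$) $\|x\|=\big\|(|x_n|^r)_{n}\big\|_{\mathcal{T}}^{1/r}$. For $1<s\le\infty$ let $\mathcal{T}_*^{(s)}$ be the dual Banach space of $\mathcal{T}^{(r)}$, where $r=s/(s-1)$ ($r=1$ if $s=\infty$). A sequence $(x_n)_{n=1}^\infty$ in a quasi-Banach space is an unconditional basic sequence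 if every vector of its closed linear span has a unique expansion $\sum_n a_nx_n$ that converges unconditionally. Two sequences $(x_n)$ and $(y_n)$ are equivalent if there is a linear homeomorphism of the closed linear span of $(x_n)$ onto that of $(y_n)$ mapping $x_n$ to $y_n$ for every $n$. A subsymmetric basic sequence is an unconditional basic sequence that is equivalent to all its subsequences. Let $0<r<\infty$ and $1<s\le\infty$. Then neither $\mathcal{T}^{(r)}$ nor $\mathcal{T}_*^{(s)}$ contains a subsymmetric basic sequence. -/

import Mathlib

open scoped ENNReal
open Filter Topology

/-! ### Unconditional and subsymmetric basic sequences -/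

section Sequences

variable (𝕜 : Type*) [RCLike 𝕜] {E : Type*} [AddCommGroup E] [Module 𝕜 E] [TopologicalSpace E]

/-- `x` is an unconditional basic sequence: every vector `f` of the closed linear span of `x` has a
unique expansion `f = ∑ aₙ xₙ` with unconditional convergence (`HasSum` is convergence along the
net of finite subsets of `ℕ`). -/
def IsUnconditionalBasicSequence (x : ℕ → E) : Prop :=
  ∀ f ∈ closure (Submodule.span 𝕜 (Set.range x) : Set E),
    ∃! a : ℕ → 𝕜, HasSum (fun n => a n • x n) f

variable [ContinuousAdd E] [ContinuousConstSMul 𝕜 E]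

/-- The closed linear span of a sequence. -/
abbrev closedSpan (x : ℕ → E) : Submodule 𝕜 E :=
  (Submodule.span 𝕜 (Set.range x)).topologicalClosure

theorem mem_closedSpan (x : ℕ → E) (n : ℕ) : x n ∈ closedSpan 𝕜 x :=
  Submodule.le_topologicalClosure _ (Submodule.subset_span (Set.mem_range_self n))

/-- Two sequences are equivalent if some linear homeomorphism between their closed linear spans
maps `x n` to `y n` for every `n`. -/
def EquivalentSequences (x y : ℕ → E) : Prop :=
  ∃ T : closedSpan 𝕜 x ≃L[𝕜] closedSpan 𝕜 y, ∀ n : ℕ,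
    T ⟨x n, mem_closedSpan 𝕜 x n⟩ = ⟨y n, mem_closedSpan 𝕜 y n⟩

/-- A subsymmetric basic sequence: an unconditional basic sequence that is equivalent to all its
subsequences. -/
def IsSubsymmetricBasicSequence (x : ℕ → E) : Prop :=
  IsUnconditionalBasicSequence 𝕜 x ∧
    ∀ φ : ℕ → ℕ, StrictMono φ → EquivalentSequences 𝕜 x (x ∘ φ)

end Sequences

/-! ### The Tsirelson norm -/

/-- `E₁ < E₂ < ⋯ < E_k` are successive finite sets of coordinates with `k ≤ min E₁`, where the
natural number `n` stands for the coordinate `n + 1`. (Empty sets are harmless: they contribute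
nothing to the sums below.) -/
def TsirelsonAdmissible {k : ℕ} (E : Fin k → Finset ℕ) : Prop :=
  (∀ i, ∀ n ∈ E i, k ≤ n + 1) ∧ ∀ i j, i < j → ∀ a ∈ E i, ∀ b ∈ E j, a < b

/-- The iterated norms: `‖x‖₀` is the supremum norm and
`‖x‖ₘ₊₁ = max ‖x‖ₘ (1/2 sup ∑ⱼ ‖Eⱼ x‖ₘ)`, the supremum over the admissible families; `x` is a
sequence of non-negative numbers, to be thought of as the moduli of a scalar sequence. -/
noncomputable def tsirelsonAux : ℕ → (ℕ → ℝ≥0∞) → ℝ≥0∞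
  | 0, x => ⨆ n, x n
  | m + 1, x => max (tsirelsonAux m x)
      (⨆ (k : ℕ) (E : Fin k → Finset ℕ) (_ : TsirelsonAdmissible E),
        (∑ j, tsirelsonAux m ((E j : Set ℕ).indicator x)) / 2)

/-- The Tsirelson norm `sup_m ‖x‖ₘ = lim_m ‖x‖ₘ` (Figiel and Johnson) of a sequence of moduli. -/
noncomputable def tsirelsonNorm (x : ℕ → ℝ≥0∞) : ℝ≥0∞ := ⨆ m, tsirelsonAux m x

/-- The `r`-convexified norm `‖ |x|^r ‖^(1/r)` of a scalar sequence (a quasi-norm if `r < 1`). -/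
noncomputable def convexifiedNorm {𝕜 : Type*} [RCLike 𝕜] (r : ℝ) (x : ℕ → 𝕜) : ℝ≥0∞ :=
  (tsirelsonNorm fun n => ‖x n‖ₑ ^ r) ^ (1 / r)

theorem tsirelsonAux_mono (m : ℕ) {x y : ℕ → ℝ≥0∞} (h : x ≤ y) :
    tsirelsonAux m x ≤ tsirelsonAux m y := by
  induction m generalizing x y with
  | zero => exact iSup_mono h
  | succ m ih =>
    simp only [tsirelsonAux]
    refine max_le_max (ih h) ?_
    refine iSup_mono fun k => iSup_mono fun E => iSup_mono fun _ => ?_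
    refine ENNReal.div_le_div_right (Finset.sum_le_sum fun j _ => ih ?_) 2
    exact fun n => Set.indicator_le_indicator (h n)

theorem tsirelsonAux_add_le (m : ℕ) (x y : ℕ → ℝ≥0∞) :
    tsirelsonAux m (x + y) ≤ tsirelsonAux m x + tsirelsonAux m y := by
  induction m generalizing x y with
  | zero => exact iSup_le fun n => add_le_add (le_iSup x n) (le_iSup y n)
  | succ m ih =>
    simp only [tsirelsonAux]
    refine max_le ((ih x y).trans (add_le_add (le_max_left _ _) (le_max_left _ _))) ?_
    refine iSup_le fun k => iSup_le fun E => iSup_le fun hE => ?_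
    have h1 : (∑ j, tsirelsonAux m ((E j : Set ℕ).indicator (x + y))) / 2 ≤
        (∑ j, tsirelsonAux m ((E j : Set ℕ).indicator x)) / 2 +
          (∑ j, tsirelsonAux m ((E j : Set ℕ).indicator y)) / 2 := by
      rw [← ENNReal.add_div, ← Finset.sum_add_distrib]
      refine ENNReal.div_le_div_right (Finset.sum_le_sum fun j _ => ?_) 2
      rw [Set.indicator_add']
      exact ih _ _
    refine h1.trans (add_le_add (le_max_of_le_right ?_) (le_max_of_le_right ?_))
    · exact le_iSup_of_le k (le_iSup_of_le E (le_iSup_of_le hE le_rfl))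
    · exact le_iSup_of_le k (le_iSup_of_le E (le_iSup_of_le hE le_rfl))

theorem tsirelsonAux_mul_le (m : ℕ) (c : ℝ≥0∞) (x : ℕ → ℝ≥0∞) :
    tsirelsonAux m (fun n => c * x n) ≤ c * tsirelsonAux m x := by
  induction m generalizing x with
  | zero => exact iSup_le fun n => mul_le_mul_right (le_iSup x n) c
  | succ m ih =>
    simp only [tsirelsonAux]
    refine max_le ((ih x).trans (mul_le_mul_right (le_max_left _ _) c)) ?_
    refine iSup_le fun k => iSup_le fun E => iSup_le fun hE => ?_
    have h1 : (∑ j, tsirelsonAux m ((E j : Set ℕ).indicator fun n => c * x n)) / 2 ≤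
        c * ((∑ j, tsirelsonAux m ((E j : Set ℕ).indicator x)) / 2) := by
      rw [← mul_div_assoc, Finset.mul_sum]
      refine ENNReal.div_le_div_right (Finset.sum_le_sum fun j _ => ?_) 2
      have : ((E j : Set ℕ).indicator fun n => c * x n) =
          fun n => c * (E j : Set ℕ).indicator x n := by
        ext n
        by_cases hn : n ∈ (E j : Set ℕ) <;> simp [Set.indicator, hn]
      rw [this]
      exact ih _
    refine h1.trans (mul_le_mul_right (le_max_of_le_right ?_) c)
    exact le_iSup_of_le k (le_iSup_of_le E (le_iSup_of_le hE le_rfl))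

theorem tsirelsonAux_le_tsum (m : ℕ) (x : ℕ → ℝ≥0∞) : tsirelsonAux m x ≤ ∑' n, x n := by
  induction m generalizing x with
  | zero => exact iSup_le fun n => ENNReal.le_tsum n
  | succ m ih =>
    simp only [tsirelsonAux]
    refine max_le (ih x) (iSup_le fun k => iSup_le fun E => iSup_le fun hE => ?_)
    have h0 : ∀ n, ∑ j, (E j : Set ℕ).indicator x n ≤ x n := by
      intro n
      by_cases hn : ∃ j, n ∈ E j
      · obtain ⟨j, hj⟩ := hn
        rw [Finset.sum_eq_single j]
        · exact Set.indicator_le_self _ _ _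
        · intro i _ hij
          refine Set.indicator_of_notMem (fun hi => ?_) _
          rcases lt_or_gt_of_ne hij with h | h
          · exact lt_irrefl _ (hE.2 i j h n hi n hj)
          · exact lt_irrefl _ (hE.2 j i h n hj n hi)
        · intro h
          exact absurd (Finset.mem_univ _) h
      · push Not at hn
        rw [Finset.sum_eq_zero]
        · exact zero_le
        · intro j _
          exact Set.indicator_of_notMem (by simpa using hn j) _
    calc (∑ j, tsirelsonAux m ((E j : Set ℕ).indicator x)) / 2
        ≤ ∑ j, tsirelsonAux m ((E j : Set ℕ).indicator x) := ENNReal.half_le_self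
      _ ≤ ∑ j, ∑' n, (E j : Set ℕ).indicator x n := Finset.sum_le_sum fun j _ => ih _
      _ = ∑' n, ∑ j, (E j : Set ℕ).indicator x n :=
          (Summable.tsum_finsetSum fun _ _ => ENNReal.summable).symm
      _ ≤ ∑' n, x n := ENNReal.tsum_le_tsum h0

theorem tsirelsonNorm_mono {x y : ℕ → ℝ≥0∞} (h : x ≤ y) : tsirelsonNorm x ≤ tsirelsonNorm y :=
  iSup_mono fun m => tsirelsonAux_mono m h

theorem tsirelsonNorm_add_le (x y : ℕ → ℝ≥0∞) :
    tsirelsonNorm (x + y) ≤ tsirelsonNorm x + tsirelsonNorm y :=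
  iSup_le fun m => (tsirelsonAux_add_le m x y).trans
    (add_le_add (le_iSup (fun m => tsirelsonAux m x) m) (le_iSup (fun m => tsirelsonAux m y) m))

theorem tsirelsonNorm_mul_le (c : ℝ≥0∞) (x : ℕ → ℝ≥0∞) :
    tsirelsonNorm (fun n => c * x n) ≤ c * tsirelsonNorm x :=
  iSup_le fun m => (tsirelsonAux_mul_le m c x).trans
    (mul_le_mul_right (le_iSup (fun m => tsirelsonAux m x) m) c)

theorem le_tsirelsonNorm (x : ℕ → ℝ≥0∞) (n : ℕ) : x n ≤ tsirelsonNorm x :=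
  (le_iSup x n).trans (le_iSup (fun m => tsirelsonAux m x) 0)

section ConvexifiedNorm

variable {𝕜 : Type*} [RCLike 𝕜] {r : ℝ}

theorem enorm_le_convexifiedNorm (hr : 0 < r) (x : ℕ → 𝕜) (n : ℕ) :
    ‖x n‖ₑ ≤ convexifiedNorm r x := by
  have h := ENNReal.rpow_le_rpow (le_tsirelsonNorm (fun n => ‖x n‖ₑ ^ r) n)
    (one_div_nonneg.2 hr.le)
  rwa [← ENNReal.rpow_mul, mul_one_div_cancel hr.ne', ENNReal.rpow_one] at h

theorem convexifiedNorm_rpow (hr : 0 < r) (x : ℕ → 𝕜) :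
    convexifiedNorm r x ^ r = tsirelsonNorm fun n => ‖x n‖ₑ ^ r := by
  rw [convexifiedNorm, ← ENNReal.rpow_mul, one_div_mul_cancel hr.ne', ENNReal.rpow_one]

theorem convexifiedNorm_zero (hr : 0 < r) : convexifiedNorm r (0 : ℕ → 𝕜) = 0 := by
  have h := tsirelsonNorm_mul_le 0 (fun _ => 0)
  simp only [zero_mul, nonpos_iff_eq_zero] at h
  simp [convexifiedNorm, hr, h]

theorem convexifiedNorm_neg (x : ℕ → 𝕜) : convexifiedNorm r (-x) = convexifiedNorm r x := by
  simp [convexifiedNorm]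

theorem convexifiedNorm_smul_le (hr : 0 < r) (c : 𝕜) (x : ℕ → 𝕜) :
    convexifiedNorm r (c • x) ≤ ‖c‖ₑ * convexifiedNorm r x := by
  have h := tsirelsonNorm_mul_le (‖c‖ₑ ^ r) (fun n => ‖x n‖ₑ ^ r)
  rw [← convexifiedNorm_rpow hr, ← ENNReal.mul_rpow_of_nonneg _ _ hr.le] at h
  rw [← ENNReal.rpow_le_rpow_iff hr, convexifiedNorm_rpow hr]
  refine le_trans (le_of_eq ?_) h
  congr 1
  ext n
  rw [Pi.smul_apply, enorm_smul, ENNReal.mul_rpow_of_nonneg _ _ hr.le]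

theorem convexifiedNorm_smul (hr : 0 < r) (c : 𝕜) (x : ℕ → 𝕜) :
    convexifiedNorm r (c • x) = ‖c‖ₑ * convexifiedNorm r x := by
  refine le_antisymm (convexifiedNorm_smul_le hr c x) ?_
  rcases eq_or_ne c 0 with rfl | hc
  · simp
  · have h := convexifiedNorm_smul_le hr c⁻¹ (c • x)
    rw [inv_smul_smul₀ hc, enorm_inv hc] at h
    have hc0 : ‖c‖ₑ ≠ 0 := by simpa using hc
    calc ‖c‖ₑ * convexifiedNorm r x ≤ ‖c‖ₑ * (‖c‖ₑ⁻¹ * convexifiedNorm r (c • x)) :=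
          mul_le_mul_right h _
      _ = convexifiedNorm r (c • x) := by
          rw [← mul_assoc, ENNReal.mul_inv_cancel hc0 enorm_ne_top, one_mul]

theorem convexifiedNorm_eq_zero (hr : 0 < r) {x : ℕ → 𝕜} (h : convexifiedNorm r x = 0) :
    x = 0 := by
  ext n
  have := enorm_le_convexifiedNorm hr x n
  rw [h] at this
  simpa using this

theorem convexifiedNorm_lt_top (hr : 0 < r) (y : ℕ →₀ 𝕜) : convexifiedNorm r y < ⊤ := by
  refine ENNReal.rpow_lt_top_of_nonneg (one_div_nonneg.2 hr.le) (ne_of_lt ?_)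
  refine lt_of_le_of_lt (iSup_le fun m => tsirelsonAux_le_tsum m _) ?_
  rw [tsum_eq_sum (s := y.support)]
  · exact ENNReal.sum_lt_top.2 fun n _ => ENNReal.rpow_lt_top_of_nonneg hr.le enorm_ne_top
  · intro n hn
    simp [Finsupp.notMem_support_iff.1 hn, hr]

/-- The triangle inequality for `r ≥ 1`. -/
theorem convexifiedNorm_add_le (hr : 1 ≤ r) (x y : ℕ → 𝕜) :
    convexifiedNorm r (x + y) ≤ convexifiedNorm r x + convexifiedNorm r y := by
  have hr0 : 0 < r := one_pos.trans_le hr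
  rcases eq_or_ne (convexifiedNorm r x) 0 with hx | hx
  · rw [convexifiedNorm_eq_zero hr0 hx, zero_add]
    exact le_add_self
  rcases eq_or_ne (convexifiedNorm r y) 0 with hy | hy
  · rw [convexifiedNorm_eq_zero hr0 hy, add_zero]
    exact le_self_add
  rcases eq_or_ne (convexifiedNorm r x) ⊤ with hx' | hx'
  · simp [hx']
  rcases eq_or_ne (convexifiedNorm r y) ⊤ with hy' | hy'
  · simp [hy']
  have hX := convexifiedNorm_rpow hr0 x
  have hY := convexifiedNorm_rpow hr0 y
  set A := convexifiedNorm r x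
  set B := convexifiedNorm r y
  have hS : A + B ≠ 0 := by simp [hx]
  have hS' : A + B ≠ ⊤ := by simp [hx', hy']
  have hAr : A ^ r ≠ 0 := by simp [hx, hr0, hx']
  have hAr' : A ^ r ≠ ⊤ := ENNReal.rpow_ne_top_of_nonneg hr0.le hx'
  have hBr : B ^ r ≠ 0 := by simp [hy, hr0, hy']
  have hBr' : B ^ r ≠ ⊤ := ENNReal.rpow_ne_top_of_nonneg hr0.le hy'
  have hw : A / (A + B) + B / (A + B) = 1 := by
    rw [← ENNReal.add_div, ENNReal.div_self hS hS']
  have key : ∀ n, ‖(x + y) n‖ₑ ^ r ≤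
      (A + B) ^ r * (A / (A + B) * ((A ^ r)⁻¹ * ‖x n‖ₑ ^ r) +
        B / (A + B) * ((B ^ r)⁻¹ * ‖y n‖ₑ ^ r)) := by
    intro n
    have h1 := ENNReal.rpow_arith_mean_le_arith_mean2_rpow (A / (A + B)) (B / (A + B))
      (A⁻¹ * ‖x n‖ₑ) (B⁻¹ * ‖y n‖ₑ) hw hr
    rw [ENNReal.mul_rpow_of_nonneg _ _ hr0.le, ENNReal.mul_rpow_of_nonneg _ _ hr0.le,
      ENNReal.inv_rpow, ENNReal.inv_rpow] at h1
    refine le_trans ?_ (mul_le_mul_right h1 ((A + B) ^ r))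
    rw [← ENNReal.mul_rpow_of_nonneg _ _ hr0.le]
    refine ENNReal.rpow_le_rpow (le_trans (enorm_add_le _ _) (le_of_eq ?_)) hr0.le
    have e : ∀ C D t : ℝ≥0∞, C ≠ 0 → C ≠ ⊤ → D ≠ 0 → D ≠ ⊤ →
        D * (C / D * (C⁻¹ * t)) = t := by
      intro C D t h1 h2 h3 h4
      rw [← mul_assoc, ENNReal.mul_div_cancel h3 h4, ← mul_assoc, ENNReal.mul_inv_cancel h1 h2,
        one_mul]
    rw [mul_add, e A _ _ hx hx' hS hS', e B _ _ hy hy' hS hS']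
  rw [← ENNReal.rpow_le_rpow_iff hr0, convexifiedNorm_rpow hr0]
  refine (tsirelsonNorm_mono key).trans ((tsirelsonNorm_mul_le _ _).trans ?_)
  have h2 : tsirelsonNorm (fun n => A / (A + B) * ((A ^ r)⁻¹ * ‖x n‖ₑ ^ r) +
        B / (A + B) * ((B ^ r)⁻¹ * ‖y n‖ₑ ^ r)) ≤ 1 := by
    refine (tsirelsonNorm_add_le _ _).trans ?_
    rw [← hw]
    refine add_le_add ?_ ?_
    · refine (tsirelsonNorm_mul_le _ _).trans (mul_le_of_le_one_right' ?_)
      refine (tsirelsonNorm_mul_le _ _).trans ?_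
      rw [← hX, ENNReal.inv_mul_cancel hAr hAr']
    · refine (tsirelsonNorm_mul_le _ _).trans (mul_le_of_le_one_right' ?_)
      refine (tsirelsonNorm_mul_le _ _).trans ?_
      rw [← hY, ENNReal.inv_mul_cancel hBr hBr']
  exact mul_le_of_le_one_right' h2

/-- The `min r 1`-th power of the convexified (quasi-)norm is subadditive for every `r > 0`. -/
theorem convexifiedNorm_rpow_add_le (hr : 0 < r) (x y : ℕ → 𝕜) :
    convexifiedNorm r (x + y) ^ min r 1 ≤
      convexifiedNorm r x ^ min r 1 + convexifiedNorm r y ^ min r 1 := by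
  rcases le_total 1 r with h | h
  · simpa [min_eq_right h] using convexifiedNorm_add_le h x y
  · rw [min_eq_left h, convexifiedNorm_rpow hr, convexifiedNorm_rpow hr, convexifiedNorm_rpow hr]
    refine (tsirelsonNorm_mono fun n => ?_).trans (tsirelsonNorm_add_le _ _)
    exact (ENNReal.rpow_le_rpow (enorm_add_le _ _) hr.le).trans
      (ENNReal.rpow_add_le_add_rpow _ _ hr.le h)

end ConvexifiedNorm

/-! ### The spaces `T^(r)` and `T_*^(s)` -/

/-- The closure of the finitely supported sequences under the convexified (quasi-)norm, i.e. their
completion realised as a space of sequences. -/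
def tsirelsonSubmodule (𝕜 : Type*) [RCLike 𝕜] (r : ℝ) [hr : Fact (0 < r)] :
    Submodule 𝕜 (ℕ → 𝕜) where
  carrier := {x | ∀ ε : ℝ≥0∞, 0 < ε → ∃ y : ℕ →₀ 𝕜, convexifiedNorm r (x - ⇑y) < ε}
  zero_mem' := fun ε hε => ⟨0, by simpa [convexifiedNorm_zero hr.out] using hε⟩
  add_mem' := by
    intro a b ha hb ε hε
    have hp : 0 < min r 1 := lt_min hr.out one_pos
    have hδ : 0 < (ε ^ min r 1 / 2) ^ (min r 1)⁻¹ :=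
      ENNReal.rpow_pos_of_nonneg (ENNReal.half_pos (ENNReal.rpow_pos_of_nonneg hε hp.le).ne')
        (inv_nonneg.2 hp.le)
    obtain ⟨y, hy⟩ := ha _ hδ
    obtain ⟨z, hz⟩ := hb _ hδ
    refine ⟨y + z, ?_⟩
    rw [← ENNReal.rpow_lt_rpow_iff hp, ← ENNReal.rpow_mul, inv_mul_cancel₀ hp.ne',
      ENNReal.rpow_one] at hy hz
    rw [← ENNReal.rpow_lt_rpow_iff hp, Finsupp.coe_add, add_sub_add_comm]
    refine (convexifiedNorm_rpow_add_le hr.out _ _).trans_lt ?_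
    calc _ < ε ^ min r 1 / 2 + ε ^ min r 1 / 2 := ENNReal.add_lt_add hy hz
      _ = _ := ENNReal.add_halves _
  smul_mem' := by
    intro c x hx ε hε
    rcases eq_or_ne c 0 with rfl | hc
    · exact ⟨0, by simpa [convexifiedNorm_zero hr.out] using hε⟩
    have hc0 : ‖c‖ₑ ≠ 0 := by simpa using hc
    obtain ⟨y, hy⟩ := hx (ε / ‖c‖ₑ) (ENNReal.div_pos hε.ne' enorm_ne_top)
    refine ⟨c • y, ?_⟩
    rw [Finsupp.coe_smul, ← smul_sub, convexifiedNorm_smul hr.out, mul_comm]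
    exact (ENNReal.lt_div_iff_mul_lt (Or.inl hc0) (Or.inl enorm_ne_top)).1 hy

/-- The `r`-convexified Tsirelson space `T^(r)`, `0 < r < ∞`, over `𝕜 = ℝ` or `ℂ`. -/
def TsirelsonSpace (𝕜 : Type*) [RCLike 𝕜] (r : ℝ) [Fact (0 < r)] : Type _ :=
  ↥(tsirelsonSubmodule 𝕜 r)

namespace TsirelsonSpace

variable {𝕜 : Type*} [RCLike 𝕜] {r : ℝ}

instance [Fact (0 < r)] : AddCommGroup (TsirelsonSpace 𝕜 r) :=
  inferInstanceAs (AddCommGroup ↥(tsirelsonSubmodule 𝕜 r))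

instance [Fact (0 < r)] : Module 𝕜 (TsirelsonSpace 𝕜 r) :=
  inferInstanceAs (Module 𝕜 ↥(tsirelsonSubmodule 𝕜 r))

/-- The underlying scalar sequence. -/
def toSeq [Fact (0 < r)] : TsirelsonSpace 𝕜 r →ₗ[𝕜] (ℕ → 𝕜) :=
  (tsirelsonSubmodule 𝕜 r).subtype

theorem convexifiedNorm_toSeq_ne_top [hr : Fact (0 < r)] (x : TsirelsonSpace 𝕜 r) :
    convexifiedNorm r (toSeq x) ≠ ⊤ := by
  have hp : 0 < min r 1 := lt_min hr.out one_pos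
  obtain ⟨y, hy⟩ := (show ∀ ε : ℝ≥0∞, 0 < ε → ∃ y : ℕ →₀ 𝕜,
    convexifiedNorm r (toSeq x - ⇑y) < ε from x.2) 1 one_pos
  have h := convexifiedNorm_rpow_add_le hr.out (toSeq x - ⇑y) ⇑y
  rw [sub_add_cancel] at h
  intro htop
  rw [htop, ENNReal.top_rpow_of_pos hp, top_le_iff, ENNReal.add_eq_top] at h
  rcases h with h | h
  · exact ENNReal.rpow_ne_top_of_nonneg hp.le (hy.trans ENNReal.one_lt_top).ne h
  · exact ENNReal.rpow_ne_top_of_nonneg hp.le (convexifiedNorm_lt_top hr.out y).ne h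

/-- The translation-invariant metric of `T^(r)` is `‖x - y‖ ^ min r 1`, where `‖·‖` is the
convexified (quasi-)norm. For `r ≥ 1` the value of the field `norm` is the norm of `T^(r)` itself;
for `r < 1` it is the `r`-th power of the quasi-norm, which defines the quasi-norm topology. -/
noncomputable instance [hr : Fact (0 < r)] : NormedAddCommGroup (TsirelsonSpace 𝕜 r) :=
  AddGroupNorm.toNormedAddCommGroup
    { toFun := fun x => (convexifiedNorm r (toSeq x)).toReal ^ min r 1
      map_zero' := by
        have hp : 0 < min r 1 := lt_min hr.out one_pos
        simp [convexifiedNorm_zero hr.out, Real.zero_rpow hp.ne']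
      add_le' := by
        intro x y
        have hp : 0 < min r 1 := lt_min hr.out one_pos
        have h := convexifiedNorm_rpow_add_le hr.out (toSeq x) (toSeq y)
        have hx := ENNReal.rpow_ne_top_of_nonneg hp.le (convexifiedNorm_toSeq_ne_top x)
        have hy := ENNReal.rpow_ne_top_of_nonneg hp.le (convexifiedNorm_toSeq_ne_top y)
        rw [map_add, ENNReal.toReal_rpow, ENNReal.toReal_rpow, ENNReal.toReal_rpow,
          ← ENNReal.toReal_add hx hy]
        exact ENNReal.toReal_mono (ENNReal.add_ne_top.2 ⟨hx, hy⟩) h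
      neg' := by
        intro x
        rw [map_neg, convexifiedNorm_neg]
      eq_zero_of_map_eq_zero' := by
        intro x hx
        have hp : 0 < min r 1 := lt_min hr.out one_pos
        rw [Real.rpow_eq_zero ENNReal.toReal_nonneg hp.ne', ENNReal.toReal_eq_zero_iff] at hx
        have h := convexifiedNorm_eq_zero hr.out (hx.resolve_right (convexifiedNorm_toSeq_ne_top x))
        exact Subtype.ext h }

theorem norm_def [Fact (0 < r)] (x : TsirelsonSpace 𝕜 r) :
    ‖x‖ = (convexifiedNorm r (toSeq x)).toReal ^ min r 1 := rfl

theorem norm_smul_eq [hr : Fact (0 < r)] (c : 𝕜) (x : TsirelsonSpace 𝕜 r) :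
    ‖c • x‖ = ‖c‖ ^ min r 1 * ‖x‖ := by
  rw [norm_def, norm_def, map_smul, convexifiedNorm_smul hr.out, ENNReal.toReal_mul,
    Real.mul_rpow ENNReal.toReal_nonneg ENNReal.toReal_nonneg, toReal_enorm]

instance [Fact (0 < r)] : ContinuousConstSMul 𝕜 (TsirelsonSpace 𝕜 r) where
  continuous_const_smul c :=
    AddMonoidHomClass.continuous_of_bound (DistribSMul.toAddMonoidHom (TsirelsonSpace 𝕜 r) c)
      (‖c‖ ^ min r 1) fun x => (norm_smul_eq c x).le

instance fact_pos_of_one_le [h : Fact (1 ≤ r)] : Fact (0 < r) := ⟨one_pos.trans_le h.out⟩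

/-- For `r ≥ 1` the norm of `T^(r)` is the convexified norm. -/
theorem norm_eq [h : Fact (1 ≤ r)] (x : TsirelsonSpace 𝕜 r) :
    ‖x‖ = (convexifiedNorm r (toSeq x)).toReal := by
  rw [norm_def, min_eq_right h.out, Real.rpow_one]

noncomputable instance [h : Fact (1 ≤ r)] : NormedSpace 𝕜 (TsirelsonSpace 𝕜 r) where
  norm_smul_le c x := by
    rw [norm_smul_eq, min_eq_right h.out, Real.rpow_one]

end TsirelsonSpace

/-- The exponent `s / (s - 1) = 1 + 1 / (s - 1)` conjugate to `1 < s ≤ ∞`; it is `1` for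
`s = ∞`. -/
noncomputable def conjugateExponent (s : ℝ≥0∞) : ℝ := (ENNReal.conjExponent s).toReal

instance fact_one_le_conjugateExponent {s : ℝ≥0∞} [hs : Fact (1 < s)] :
    Fact (1 ≤ conjugateExponent s) := by
  have h0 : s - 1 ≠ 0 := (tsub_pos_of_lt hs.out).ne'
  refine ⟨?_⟩
  rw [conjugateExponent, ENNReal.conjExponent,
    ENNReal.toReal_add ENNReal.one_ne_top (ENNReal.inv_ne_top.2 h0), ENNReal.toReal_one]
  exact le_add_of_nonneg_right ENNReal.toReal_nonneg

/-- The space `T_*^(s)`, `1 < s ≤ ∞`: the Banach space dual of `T^(r)` with `r = s / (s - 1)`,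
with the dual norm. -/
abbrev TsirelsonDual (𝕜 : Type*) [RCLike 𝕜] (s : ℝ≥0∞) [Fact (1 < s)] : Type _ :=
  StrongDual 𝕜 (TsirelsonSpace 𝕜 (conjugateExponent s))

/-! ### The Tsirelson norm on sequences of moduli -/

open scoped NNReal

/-! Two features of the Tsirelson norm conflict as soon as a sequence is equivalent to all its
subsequences. Few far out blocks behave like `ℓ₁`: half the sum of their norms is a lower bound for
the norm of the sum (`sum_tsirelsonNorm_Ico_le`). Yet no bounded block sequence has a lower `ℓ₁`
estimate for all combinations: averaging one block with very many later ones improves the bound on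
the norms by a factor 7/8, and this can be iterated (`exists_mem_tsirelsonNorm_lt`). Applied to the
moduli `|x|^r`, both facts become statements about `ℓ_r` in `T^(r)`.

A subsymmetric sequence has no convergent subsequence, so differences along a coordinatewise
convergent subsequence, followed by a gliding hump, give a seminormalised sequence close to blocks
and still equivalent to its subsequences (`IsSubsymmetricBasicSequence.exists_near_blocks`). Along a
sparse subsequence the combinations that would violate the `ℓ_r` estimate consist of few far out
blocks (`exists_strictMono_card_le`); equivalence therefore gives the estimate on a tail of the
sequence itself, against the averaging fact.

For the dual, averaging also shows that functionals are small on far out vectors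
(`exists_norm_apply_restrict_Ico_le`), so the coordinate functionals form a basis and the same
reduction applies. The lower `ℓ_r` estimate dualises to an upper estimate for few far out functional
blocks, which spreads to a tail. It fails against norming block vectors combined to small norm. -/

theorem monotone_tsirelsonAux (x : ℕ → ℝ≥0∞) : Monotone fun m => tsirelsonAux m x :=
  monotone_nat_of_le_succ fun _ => le_max_left _ _

/-- The inequality between levels `m` and `m + 1` passes to the limit because finite sums commute
with monotone suprema. With the next lemma this is the implicit Figiel-Johnson equation, which
replaces the iterated norms in most of what follows. -/
theorem TsirelsonAdmissible.sum_tsirelsonNorm_le {k : ℕ} {E : Fin k → Finset ℕ}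
    (hE : TsirelsonAdmissible E) (x : ℕ → ℝ≥0∞) :
    (∑ j, tsirelsonNorm ((E j : Set ℕ).indicator x)) / 2 ≤ tsirelsonNorm x := by
  simp only [tsirelsonNorm]
  rw [ENNReal.finsetSum_iSup_of_monotone fun j => monotone_tsirelsonAux _, ENNReal.iSup_div]
  refine iSup_le fun m => le_trans ?_ (le_iSup (fun m => tsirelsonAux m x) (m + 1))
  exact le_max_of_le_right (le_iSup_of_le k (le_iSup_of_le E (le_iSup_of_le hE le_rfl)))

theorem tsirelsonNorm_le_of_forall_admissible {x : ℕ → ℝ≥0∞} {A : ℝ≥0∞} (h0 : ∀ n, x n ≤ A)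
    (h : ∀ (k : ℕ) (E : Fin k → Finset ℕ), TsirelsonAdmissible E →
      (∑ j, tsirelsonNorm ((E j : Set ℕ).indicator x)) / 2 ≤ A) : tsirelsonNorm x ≤ A := by
  refine iSup_le fun m => ?_
  induction m with
  | zero => exact iSup_le h0
  | succ m ih =>
    refine max_le ih (iSup_le fun k => iSup_le fun E => iSup_le fun hE => le_trans ?_ (h k E hE))
    exact ENNReal.div_le_div_right (Finset.sum_le_sum fun j _ =>
      le_iSup (fun m => tsirelsonAux m ((E j : Set ℕ).indicator x)) m) 2

theorem tsirelsonNorm_zero : tsirelsonNorm (0 : ℕ → ℝ≥0∞) = 0 := by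
  have h := tsirelsonNorm_mul_le 0 (0 : ℕ → ℝ≥0∞)
  simpa [← Pi.zero_def] using h

theorem tsirelsonNorm_indicator_le (s : Set ℕ) (x : ℕ → ℝ≥0∞) :
    tsirelsonNorm (s.indicator x) ≤ tsirelsonNorm x :=
  tsirelsonNorm_mono (Set.indicator_le_self s x)

theorem tsirelsonNorm_sum_le {ι : Type*} (s : Finset ι) (x : ι → ℕ → ℝ≥0∞) :
    tsirelsonNorm (∑ i ∈ s, x i) ≤ ∑ i ∈ s, tsirelsonNorm (x i) := by
  classical
  induction s using Finset.induction_on with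
  | empty => simp [tsirelsonNorm_zero]
  | insert i s hi ih =>
    rw [Finset.sum_insert hi, Finset.sum_insert hi]
    exact (tsirelsonNorm_add_le _ _).trans (by gcongr)

/-- The lower estimate for finitely many pieces of a sequence lying on successive intervals. -/
theorem sum_tsirelsonNorm_Ico_le {N : ℕ → ℕ} (hN : StrictMono N) (s : Finset ℕ)
    (hs : ∀ k ∈ s, s.card ≤ k) (x : ℕ → ℝ≥0∞) :
    (∑ k ∈ s, tsirelsonNorm ((Set.Ico (N k) (N (k + 1))).indicator x)) / 2 ≤ tsirelsonNorm x := by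
  have hE : TsirelsonAdmissible fun j : Fin s.card =>
      Finset.Ico (N (s.orderEmbOfFin rfl j)) (N (s.orderEmbOfFin rfl j + 1)) := by
    -- Admissibility: `s.card ≤ k ≤ N k ≤ n` for every `n` in the `k`-th interval.
    refine ⟨fun i n hn => ?_, fun i j hij a ha b hb => ?_⟩
    · have h1 := hs _ (s.orderEmbOfFin_mem rfl i)
      have h2 := hN.id_le (s.orderEmbOfFin rfl i)
      have h3 := (Finset.mem_Ico.1 hn).1
      simp only [id] at h2
      omega
    · have h1 : s.orderEmbOfFin rfl i + 1 ≤ s.orderEmbOfFin rfl j :=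
        (s.orderEmbOfFin rfl).strictMono hij
      have h2 := hN.monotone h1
      have h3 := (Finset.mem_Ico.1 ha).2
      have h4 := (Finset.mem_Ico.1 hb).1
      omega
  refine le_trans (le_of_eq ?_) (hE.sum_tsirelsonNorm_le x)
  congr 1
  have h := Finset.sum_image (s := Finset.univ) (g := s.orderEmbOfFin rfl)
    (f := fun k => tsirelsonNorm ((Set.Ico (N k) (N (k + 1))).indicator x))
    (s.orderEmbOfFin rfl).injective.injOn
  rw [Finset.image_orderEmbOfFin_univ] at h
  simpa using h

/-- Only suprema, finite sums and restrictions of coordinates occur. The consequence needed is that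
norm bounds survive coordinatewise limits, which gives completeness. -/
theorem lowerSemicontinuous_tsirelsonAux (m : ℕ) : LowerSemicontinuous (tsirelsonAux m) := by
  induction m with
  | zero => exact lowerSemicontinuous_iSup fun n => (continuous_apply n).lowerSemicontinuous
  | succ m ih =>
    refine ih.sup (lowerSemicontinuous_iSup fun k => lowerSemicontinuous_iSup fun E =>
      lowerSemicontinuous_iSup fun hE => ?_)
    have hsum : LowerSemicontinuous fun x : ℕ → ℝ≥0∞ =>
        ∑ j, tsirelsonAux m ((E j : Set ℕ).indicator x) := by
      refine lowerSemicontinuous_sum fun j _ => ih.comp (continuous_pi fun n => ?_)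
      by_cases hn : n ∈ E j
      · simpa [Set.indicator, hn] using continuous_apply n
      · simpa [Set.indicator, hn] using continuous_const
    exact Continuous.comp_lowerSemicontinuous (g := fun t : ℝ≥0∞ => t / 2)
      (ENNReal.continuous_div_const 2 two_ne_zero) hsum fun a b h => ENNReal.div_le_div_right h 2

theorem lowerSemicontinuous_tsirelsonNorm : LowerSemicontinuous tsirelsonNorm :=
  lowerSemicontinuous_iSup lowerSemicontinuous_tsirelsonAux

/-! ### Averaging far out blocks lowers the Tsirelson norm. -/

/-- Successive sets in a family and successive blocks meet in at most as many pairs as the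
two families have members together. -/
theorem card_meeting_pairs_le {l k : ℕ} (E : Fin l → Finset ℕ)
    (hE : ∀ i j, i < j → ∀ a ∈ E i, ∀ b ∈ E j, a < b) (N : ℕ → ℕ) (hN : Monotone N) :
    ((Finset.univ ×ˢ Finset.range k).filter fun p : Fin l × ℕ =>
      ∃ n ∈ E p.1, N p.2 ≤ n ∧ n < N (p.2 + 1)).card ≤ l + k := by
  classical
  -- Meeting pairs form a chain, monotone in both indices, so the sum of the indices determines the
  -- pair.
  refine (Finset.card_le_card_of_injOn (fun p : Fin l × ℕ => (p.1 : ℕ) + p.2)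
    (t := Finset.range (l + k)) ?_ ?_).trans_eq (Finset.card_range _)
  · intro p hp
    simp only [Finset.coe_filter, Finset.mem_product, Finset.mem_univ, Finset.mem_range, true_and,
      Set.mem_ofPred_eq] at hp
    have := p.1.2
    simp only [Finset.coe_range, Set.mem_Iio]
    omega
  · have key : ∀ i i' : Fin l, ∀ j j' : ℕ, (∃ n ∈ E i, N j ≤ n ∧ n < N (j + 1)) →
        (∃ n ∈ E i', N j' ≤ n ∧ n < N (j' + 1)) → i < i' → j ≤ j' := by
      rintro i i' j j' ⟨n, hn, h1, h2⟩ ⟨n', hn', h1', h2'⟩ hi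
      by_contra! hj
      have := hE i i' hi n hn n' hn'
      have := hN (Nat.succ_le_of_lt hj)
      simp only [Nat.succ_eq_add_one] at this
      omega
    rintro ⟨i, j⟩ hp ⟨i', j'⟩ hp' heq
    simp only [Finset.coe_filter, Finset.mem_product, Finset.mem_univ, Finset.mem_range, true_and,
      Set.mem_ofPred_eq] at hp hp' heq
    rcases lt_trichotomy i i' with h | h | h
    · have := key i i' j j' hp.2 hp'.2 h
      have : (i : ℕ) < i' := h
      omega
    · subst h
      simp only [Prod.mk.injEq, true_and]
      omega
    · have := key i' i j' j hp'.2 hp.2 h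
      have : (i' : ℕ) < i := h
      omega

/-- A block followed by an average of many later blocks has a norm distinctly smaller than
the sum of the norms. -/
theorem tsirelsonNorm_block_add_sum_le {v : ℕ → ℕ → ℝ≥0∞} {N : ℕ → ℕ} (hN : Monotone N)
    (hv : ∀ j n, v j n ≠ 0 → N j ≤ n ∧ n < N (j + 1)) {A : ℝ≥0∞}
    (hA : ∀ j, tsirelsonNorm (v j) ≤ A) {L : ℕ} (hL1 : N 1 ≤ L) :
    tsirelsonNorm ((fun n => (2 * L : ℕ) * v 0 n) + ∑ j ∈ Finset.range (2 * L), v (j + 1)) ≤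
      7 / 2 * (L * A) := by
  classical
  set f : ℕ → ℝ≥0∞ := fun n => (2 * L : ℕ) * v 0 n with hf
  set g : ℕ → ℝ≥0∞ := ∑ j ∈ Finset.range (2 * L), v (j + 1) with hg
  have hfA : tsirelsonNorm f ≤ (2 * L : ℕ) * A :=
    (tsirelsonNorm_mul_le _ _).trans (mul_le_mul_right (hA 0) _)
  have hgA : tsirelsonNorm g ≤ (2 * L : ℕ) * A := by
    refine (tsirelsonNorm_sum_le _ _).trans ((Finset.sum_le_sum fun j _ => hA _).trans ?_)
    simp
  have h2 : ((2 * L : ℕ) : ℝ≥0∞) * A ≤ 7 / 2 * (L * A) := by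
    rw [Nat.cast_mul, mul_assoc]
    gcongr
    rw [ENNReal.le_div_iff_mul_le (by simp) (by simp)]
    norm_num
  have hfg : ∀ n, f n = 0 ∨ g n = 0 := by
    intro n
    by_cases h : n < N 1
    · right
      rw [hg, Finset.sum_apply]
      refine Finset.sum_eq_zero fun j _ => ?_
      by_contra h0
      have := (hv _ _ h0).1
      have := hN (show 1 ≤ j + 1 by omega)
      omega
    · left
      have : v 0 n = 0 := by
        by_contra h0
        exact h (hv _ _ h0).2
      simp [hf, this]
  refine tsirelsonNorm_le_of_forall_admissible (fun n => ?_) fun l E hE => ?_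
  · rw [Pi.add_apply]
    rcases hfg n with h | h
    · rw [h, zero_add]
      exact (le_tsirelsonNorm g n).trans (hgA.trans h2)
    · rw [h, add_zero]
      exact (le_tsirelsonNorm f n).trans (hfA.trans h2)
  -- A family reaching the region of the first block has at most `L` members, too few for the many
  -- later blocks; any other family does not see the first block at all.
  by_cases hm : ∃ i, ∃ n ∈ E i, n < N 1
  · obtain ⟨i, n, hn, hn1⟩ := hm
    have hl : l ≤ L := by
      have := hE.1 i n hn
      omega
    have h3 : (∑ i, tsirelsonNorm ((E i : Set ℕ).indicator (f + g))) / 2 ≤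
        (∑ i, tsirelsonNorm ((E i : Set ℕ).indicator f)) / 2 +
          (∑ i, tsirelsonNorm ((E i : Set ℕ).indicator g)) / 2 := by
      rw [← ENNReal.add_div, ← Finset.sum_add_distrib]
      refine ENNReal.div_le_div_right (Finset.sum_le_sum fun j _ => ?_) 2
      rw [Set.indicator_add']
      exact tsirelsonNorm_add_le _ _
    -- At most `l + 2L ≤ 3L` pieces are nonzero. After halving, `g` contributes `3/2` and `f`
    -- contributes `2`, whence `7/2`.
    have h4 : ∑ i, tsirelsonNorm ((E i : Set ℕ).indicator g) ≤ (3 * L : ℕ) * A := by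
      calc ∑ i, tsirelsonNorm ((E i : Set ℕ).indicator g)
          ≤ ∑ i, ∑ j ∈ Finset.range (2 * L),
              tsirelsonNorm ((E i : Set ℕ).indicator (v (j + 1))) := by
            refine Finset.sum_le_sum fun i _ => ?_
            refine le_trans (le_of_eq ?_) (tsirelsonNorm_sum_le _ _)
            congr 1
            ext n
            by_cases hn : n ∈ E i <;> simp [hg, Set.indicator, hn]
        _ = ∑ p ∈ Finset.univ ×ˢ Finset.range (2 * L),
              tsirelsonNorm ((E p.1 : Set ℕ).indicator (v (p.2 + 1))) :=
            (Finset.sum_product' _ _ _).symm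
        _ ≤ ∑ p ∈ Finset.univ ×ˢ Finset.range (2 * L),
              if ∃ n ∈ E p.1, N (p.2 + 1) ≤ n ∧ n < N (p.2 + 1 + 1) then A else 0 := by
            refine Finset.sum_le_sum fun p _ => ?_
            split_ifs with hp
            · exact (tsirelsonNorm_indicator_le _ _).trans (hA _)
            · have : (E p.1 : Set ℕ).indicator (v (p.2 + 1)) = 0 := by
                ext n
                by_cases hn : n ∈ E p.1
                · simp only [Set.indicator, Finset.mem_coe, hn, if_true, Pi.zero_apply]
                  by_contra h0
                  exact hp ⟨n, hn, hv _ _ h0⟩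
                · simp [Set.indicator, hn]
              rw [this, tsirelsonNorm_zero]
        _ ≤ (3 * L : ℕ) * A := by
            rw [← Finset.sum_filter, Finset.sum_const, nsmul_eq_mul]
            gcongr
            have := card_meeting_pairs_le (k := 2 * L) E hE.2 (fun j => N (j + 1))
              (fun a b h => hN (by omega))
            omega
    calc (∑ i, tsirelsonNorm ((E i : Set ℕ).indicator (f + g))) / 2
        ≤ (2 * L : ℕ) * A + (3 * L : ℕ) * A / 2 :=
          h3.trans (add_le_add ((hE.sum_tsirelsonNorm_le f).trans hfA)
            (ENNReal.div_le_div_right h4 2))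
      _ = 7 / 2 * (L * A) := by
          have h7 : (7 / 2 : ℝ≥0∞) = 2 + 3 / 2 := by
            rw [eq_comm, ENNReal.eq_div_iff (by simp) (by simp), mul_add,
              ENNReal.mul_div_cancel (by simp) (by simp)]
            norm_num
          rw [h7, add_mul]
          push_cast
          simp only [div_eq_mul_inv]
          ring
  · have h5 : ∀ i, (E i : Set ℕ).indicator (f + g) = (E i : Set ℕ).indicator g := by
      intro i
      ext n
      by_cases hn : n ∈ E i
      · have : v 0 n = 0 := by
          by_contra h0
          exact hm ⟨i, n, hn, (hv _ _ h0).2⟩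
        simp [Set.indicator, hn, hf, this]
      · simp [Set.indicator, hn]
    simp only [h5]
    exact (hE.sum_tsirelsonNorm_le g).trans (hgA.trans h2)

/-- A convex set which contains vectors of bounded norm with finite supports arbitrarily far
out contains vectors of arbitrarily small norm. -/
theorem exists_mem_tsirelsonNorm_lt {C : Set (ℕ → ℝ≥0∞)}
    (hC : ∀ (s : Finset ℕ) (w : ℕ → ℝ≥0) (v : ℕ → ℕ → ℝ≥0∞), ∑ j ∈ s, w j = 1 →
      (∀ j ∈ s, v j ∈ C) → ∑ j ∈ s, w j • v j ∈ C)
    {B : ℝ≥0∞} (hB : B ≠ ⊤)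
    (hfar : ∀ N, ∃ x ∈ C, (∃ M, ∀ n, x n ≠ 0 → N ≤ n ∧ n < M) ∧ tsirelsonNorm x ≤ B)
    {c : ℝ≥0∞} (hc : 0 < c) : ∃ x ∈ C, tsirelsonNorm x < c := by
  have step : ∀ A : ℝ≥0∞,
      (∀ N, ∃ x ∈ C, (∃ M, ∀ n, x n ≠ 0 → N ≤ n ∧ n < M) ∧ tsirelsonNorm x ≤ A) →
      ∀ N, ∃ x ∈ C, (∃ M, ∀ n, x n ≠ 0 → N ≤ n ∧ n < M) ∧ tsirelsonNorm x ≤ 7 / 8 * A := by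
    intro A h N₀
    choose F hFC hFM hFA using h
    choose G hG using hFM
    obtain ⟨N, hN0, hN1⟩ : ∃ N : ℕ → ℕ, N 0 = N₀ ∧
        ∀ j, N (j + 1) = max (G (N j)) (N j + 1) :=
      ⟨fun j => Nat.rec N₀ (fun _ m => max (G m) (m + 1)) j, rfl, fun j => rfl⟩
    have hNm : StrictMono N := strictMono_nat_of_lt_succ fun j => by rw [hN1]; omega
    have hv : ∀ j n, F (N j) n ≠ 0 → N j ≤ n ∧ n < N (j + 1) := by
      intro j n hn
      have := hG _ n hn
      rw [hN1]
      omega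
    have hL : N 1 ≠ 0 := by rw [← zero_add 1, hN1]; omega
    have hmain := tsirelsonNorm_block_add_sum_le hNm.monotone hv (fun j => hFA _) le_rfl
    set L : ℕ := N 1
    have hLR : (L : ℝ≥0∞) ≠ 0 := by exact_mod_cast hL
    have hLN : (L : ℝ≥0) ≠ 0 := by exact_mod_cast hL
    -- Half the weight goes to the first block, the rest equally to the next `2L`; scaling `7/2 * L`
    -- by `1/(4L)` leaves `7/8`.
    let w : ℕ → ℝ≥0 := fun j => if j = 0 then 2⁻¹ else (4 * L : ℝ≥0)⁻¹
    have hx : ∑ j ∈ Finset.range (2 * L + 1), w j • F (N j) = fun n => (4 * L : ℝ≥0∞)⁻¹ *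
        ((fun n => (2 * L : ℕ) * F (N 0) n) +
          ∑ j ∈ Finset.range (2 * L), F (N (j + 1))) n := by
      ext n
      have h2 : (2⁻¹ : ℝ≥0∞) = (4 * L : ℝ≥0∞)⁻¹ * (2 * L) := by
        rw [show (4 * L : ℝ≥0∞) = 2 * (2 * L) by ring,
          ENNReal.mul_inv (by simp) (by simp), mul_assoc, ENNReal.inv_mul_cancel, mul_one]
        · simp [hLR]
        · exact ENNReal.mul_ne_top (by simp) (by simp)
      rw [Finset.sum_range_succ', Pi.add_apply, Pi.add_apply, mul_add, add_comm]
      congr 1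
      · simp only [w, if_true, Pi.smul_apply, ENNReal.smul_def, smul_eq_mul]
        rw [ENNReal.coe_inv two_ne_zero, ENNReal.coe_ofNat, h2]
        push_cast
        ring
      · simp only [w, Nat.succ_ne_zero, if_false, Finset.sum_apply, Pi.smul_apply,
          ENNReal.smul_def, smul_eq_mul]
        rw [← Finset.mul_sum, ENNReal.coe_inv (mul_ne_zero four_ne_zero hLN)]
        push_cast
        rfl
    refine ⟨_, hC (Finset.range (2 * L + 1)) w (fun j => F (N j)) ?_ fun j _ => hFC _, ?_, ?_⟩
    · rw [Finset.sum_range_succ']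
      simp only [w, Nat.succ_ne_zero, if_false, if_true, Finset.sum_const, Finset.card_range,
        nsmul_eq_mul]
      push_cast
      field_simp
      norm_num
    · refine ⟨N (2 * L + 1), fun n hn => ?_⟩
      rw [Finset.sum_apply] at hn
      obtain ⟨j, hj, hj'⟩ := Finset.exists_ne_zero_of_sum_ne_zero hn
      have hj0 : F (N j) n ≠ 0 := by
        intro h0
        simp [h0] at hj'
      have h1 := hv j n hj0
      have h2 := hNm.monotone (Nat.zero_le j)
      have h3 := hNm.monotone (Nat.succ_le_of_lt (Finset.mem_range.1 hj))
      simp only [Nat.succ_eq_add_one] at h3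
      exact ⟨hN0 ▸ h2.trans h1.1, h1.2.trans_le h3⟩
    · rw [hx]
      refine (tsirelsonNorm_mul_le _ _).trans ((mul_le_mul_right hmain _).trans (le_of_eq ?_))
      rw [ENNReal.mul_inv (by simp) (by simp), show (8 : ℝ≥0∞) = 2 * 4 by norm_num, div_eq_mul_inv,
        div_eq_mul_inv, ENNReal.mul_inv (by simp) (by simp)]
      calc (4 : ℝ≥0∞)⁻¹ * (L : ℝ≥0∞)⁻¹ * (7 * 2⁻¹ * (L * A))
          = 7 * (2⁻¹ * 4⁻¹) * A * ((L : ℝ≥0∞)⁻¹ * L) := by ring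
        _ = _ := by rw [ENNReal.inv_mul_cancel hLR (by simp), mul_one]
  -- The averages again lie in `C` and arbitrarily far out, so the improvement can be repeated.
  have hall : ∀ m : ℕ, ∀ N, ∃ x ∈ C, (∃ M, ∀ n, x n ≠ 0 → N ≤ n ∧ n < M) ∧
      tsirelsonNorm x ≤ (7 / 8) ^ m * B := by
    intro m
    induction m with
    | zero => simpa using hfar
    | succ m ih => simpa [pow_succ', mul_assoc] using step _ ih
  have hlim : Tendsto (fun m : ℕ => (7 / 8 : ℝ≥0∞) ^ m * B) atTop (𝓝 0) := by
    have h78 : (7 / 8 : ℝ≥0∞) < 1 := by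
      rw [ENNReal.div_lt_iff (by simp) (by simp)]
      norm_num
    simpa using ENNReal.Tendsto.mul_const
      (ENNReal.tendsto_pow_atTop_nhds_zero_of_lt_one h78) (Or.inr hB)
  obtain ⟨m, hm⟩ := (hlim.eventually (gt_mem_nhds hc)).exists
  obtain ⟨x, hxC, -, hx⟩ := hall m 0
  exact ⟨x, hxC, hx.trans_lt hm⟩

/-- No bounded block sequence of the Tsirelson space admits a lower `ℓ₁` estimate. -/
theorem exists_convex_combination_tsirelsonNorm_lt {w : ℕ → ℕ → ℝ≥0∞} {N : ℕ → ℕ}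
    (hN : StrictMono N) (hw : ∀ j n, w j n ≠ 0 → N j ≤ n ∧ n < N (j + 1)) {B : ℝ≥0∞}
    (hB : B ≠ ⊤) (hwB : ∀ j, tsirelsonNorm (w j) ≤ B) (K : ℕ) {c : ℝ≥0∞} (hc : 0 < c) :
    ∃ (s : Finset ℕ) (a : ℕ → ℝ≥0), (∀ k ∈ s, K ≤ k) ∧ ∑ k ∈ s, a k = 1 ∧
      tsirelsonNorm (∑ k ∈ s, a k • w k) < c := by
  classical
  let C : Set (ℕ → ℝ≥0∞) := {x | ∃ a : ℕ →₀ ℝ≥0, (∀ k ∈ a.support, K ≤ k) ∧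
    Finsupp.linearCombination ℝ≥0 (fun _ : ℕ => (1 : ℝ≥0)) a = 1 ∧
    Finsupp.linearCombination ℝ≥0 w a = x}
  suffices h : ∃ x ∈ C, tsirelsonNorm x < c by
    obtain ⟨x, ⟨a, haK, ha1, rfl⟩, hx⟩ := h
    exact ⟨a.support, a, haK, by simpa [Finsupp.linearCombination_apply, Finsupp.sum] using ha1, hx⟩
  refine exists_mem_tsirelsonNorm_lt ?_ hB ?_ hc
  · intro s b v hb hv
    choose! a haK ha1 hav using hv
    refine ⟨∑ j ∈ s, b j • a j, fun k hk => ?_, ?_, ?_⟩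
    · obtain ⟨j, hj, hkj⟩ := Finset.mem_biUnion.1 (Finsupp.support_finsetSum hk)
      exact haK j hj k (Finsupp.support_smul hkj)
    · rw [map_sum]
      refine (Finset.sum_congr rfl fun j hj => ?_).trans hb
      rw [map_smul, ha1 j hj, smul_eq_mul, mul_one]
    · rw [map_sum]
      exact Finset.sum_congr rfl fun j hj => by rw [map_smul, hav j hj]
  · intro M
    refine ⟨w (max K M), ⟨Finsupp.single (max K M) 1, ?_, by simp, by simp⟩,
      ⟨N (max K M + 1), fun n hn => ?_⟩, hwB _⟩
    · intro k hk
      rw [Finset.mem_singleton.1 (Finsupp.support_single_subset hk)]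
      exact le_max_left _ _
    · have h1 := hw _ n hn
      have h2 := hN.id_le (max K M)
      simp only [id] at h2
      omega

/-! ### The unit vector basis and completeness of `T^(r)` -/

section ConvexifiedNorm

variable {𝕜 : Type*} [RCLike 𝕜] {r : ℝ}

theorem convexifiedNorm_mono (hr : 0 < r) {x y : ℕ → 𝕜} (h : ∀ n, ‖x n‖ₑ ≤ ‖y n‖ₑ) :
    convexifiedNorm r x ≤ convexifiedNorm r y :=
  ENNReal.rpow_le_rpow (tsirelsonNorm_mono fun n => ENNReal.rpow_le_rpow (h n) hr.le)
    (one_div_nonneg.2 hr.le)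

theorem isClosed_convexifiedNorm_rpow_le (hr : 0 < r) (c : ℝ≥0∞) :
    IsClosed {x : ℕ → 𝕜 | convexifiedNorm r x ^ min r 1 ≤ c} := by
  have hp : 0 < min r 1 := lt_min hr one_pos
  have h1 : LowerSemicontinuous fun x : ℕ → 𝕜 => tsirelsonNorm fun n => ‖x n‖ₑ ^ r :=
    lowerSemicontinuous_tsirelsonNorm.comp (continuous_pi fun n =>
      (ENNReal.continuous_rpow_const).comp (continuous_apply n).enorm)
  have h2 := Continuous.comp_lowerSemicontinuous (g := fun t : ℝ≥0∞ => (t ^ (1 / r)) ^ min r 1)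
    (ENNReal.continuous_rpow_const.comp ENNReal.continuous_rpow_const) h1 fun a b h =>
      ENNReal.rpow_le_rpow (ENNReal.rpow_le_rpow h (one_div_nonneg.2 hr.le)) hp.le
  exact h2.isClosed_preimage c

theorem mem_tsirelsonSubmodule_iff [hr : Fact (0 < r)] {f : ℕ → 𝕜} :
    f ∈ tsirelsonSubmodule 𝕜 r ↔
      ∀ ε : ℝ≥0∞, 0 < ε → ∃ y : ℕ →₀ 𝕜, convexifiedNorm r (f - ⇑y) ^ min r 1 < ε := by
  have hp : 0 < min r 1 := lt_min hr.out one_pos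
  refine ⟨fun h ε hε => ?_, fun h ε hε => ?_⟩
  · obtain ⟨y, hy⟩ := h (ε ^ (min r 1)⁻¹) (ENNReal.rpow_pos_of_nonneg hε (inv_nonneg.2 hp.le))
    refine ⟨y, ?_⟩
    rwa [← ENNReal.rpow_lt_rpow_iff hp, ← ENNReal.rpow_mul, inv_mul_cancel₀ hp.ne',
      ENNReal.rpow_one] at hy
  · obtain ⟨y, hy⟩ := h (ε ^ min r 1) (ENNReal.rpow_pos_of_nonneg hε hp.le)
    exact ⟨y, (ENNReal.rpow_lt_rpow_iff hp).1 hy⟩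

end ConvexifiedNorm

namespace TsirelsonSpace

variable {𝕜 : Type*} [RCLike 𝕜] {r : ℝ}

theorem toSeq_injective [Fact (0 < r)] :
    Function.Injective (toSeq : TsirelsonSpace 𝕜 r →ₗ[𝕜] ℕ → 𝕜) :=
  Subtype.val_injective

theorem toSeq_mem [Fact (0 < r)] (x : TsirelsonSpace 𝕜 r) : toSeq x ∈ tsirelsonSubmodule 𝕜 r :=
  x.2

theorem exists_toSeq_eq [Fact (0 < r)] {f : ℕ → 𝕜} (hf : f ∈ tsirelsonSubmodule 𝕜 r) :
    ∃ x : TsirelsonSpace 𝕜 r, toSeq x = f :=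
  ⟨⟨f, hf⟩, rfl⟩

theorem enorm_eq [hr : Fact (0 < r)] (x : TsirelsonSpace 𝕜 r) :
    ‖x‖ₑ = convexifiedNorm r (toSeq x) ^ min r 1 := by
  have hp : 0 < min r 1 := lt_min hr.out one_pos
  rw [← ofReal_norm, norm_def, ENNReal.toReal_rpow, ENNReal.ofReal_toReal]
  exact ENNReal.rpow_ne_top_of_nonneg hp.le (convexifiedNorm_toSeq_ne_top x)

/-- The norm is the `min r 1`-th power of the quasi-norm, so the exponent `r / min r 1` recovers its
`r`-th power. This treats `r < 1` and `r ≥ 1` together. -/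
theorem tsirelsonNorm_eq_enorm [hr : Fact (0 < r)] (x : TsirelsonSpace 𝕜 r) :
    (tsirelsonNorm fun n => ‖toSeq x n‖ₑ ^ r) = ‖x‖ₑ ^ (r / min r 1) := by
  have hp : 0 < min r 1 := lt_min hr.out one_pos
  rw [enorm_eq, ← ENNReal.rpow_mul, mul_div_cancel₀ _ hp.ne', convexifiedNorm_rpow hr.out]

theorem norm_le_norm_of_forall_le [hr : Fact (0 < r)] {x y : TsirelsonSpace 𝕜 r}
    (h : ∀ n, ‖toSeq x n‖ ≤ ‖toSeq y n‖) : ‖x‖ ≤ ‖y‖ := by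
  have hp : 0 < min r 1 := lt_min hr.out one_pos
  rw [← enorm_le_iff_norm_le, enorm_eq, enorm_eq]
  exact ENNReal.rpow_le_rpow (convexifiedNorm_mono hr.out fun n =>
    enorm_le_iff_norm_le.2 (h n)) hp.le

theorem norm_coord_rpow_le [hr : Fact (0 < r)] (x : TsirelsonSpace 𝕜 r) (n : ℕ) :
    ‖toSeq x n‖ ^ min r 1 ≤ ‖x‖ := by
  rw [norm_def, ← toReal_enorm]
  exact Real.rpow_le_rpow ENNReal.toReal_nonneg
    (ENNReal.toReal_mono (convexifiedNorm_toSeq_ne_top x) (enorm_le_convexifiedNorm hr.out _ n))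
    (lt_min hr.out one_pos).le

theorem coe_finsupp_mem [hr : Fact (0 < r)] (y : ℕ →₀ 𝕜) : ⇑y ∈ tsirelsonSubmodule 𝕜 r :=
  fun ε hε => ⟨y, by simpa [convexifiedNorm_zero hr.out] using hε⟩

/-- The unit vectors of `T^(r)`. -/
noncomputable def unitVec (𝕜 : Type*) [RCLike 𝕜] (r : ℝ) [Fact (0 < r)] (n : ℕ) :
    TsirelsonSpace 𝕜 r :=
  ⟨⇑(Finsupp.single n (1 : 𝕜)), coe_finsupp_mem _⟩

theorem toSeq_unitVec [Fact (0 < r)] (n : ℕ) :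
    toSeq (unitVec 𝕜 r n) = Pi.single n (1 : 𝕜) :=
  Finsupp.single_eq_pi_single n 1

theorem toSeq_sum_smul_unitVec [Fact (0 < r)] (I : Finset ℕ) (a : ℕ → 𝕜) :
    toSeq (∑ n ∈ I, a n • unitVec 𝕜 r n) = (I : Set ℕ).indicator a := by
  ext m
  simp [map_sum, toSeq_unitVec, Finset.sum_apply, Pi.single_apply, Set.indicator]

/-- The partial sums of the unit vector expansion converge. -/
theorem tendsto_sum_unitVec [hr : Fact (0 < r)] (x : TsirelsonSpace 𝕜 r) :
    Tendsto (fun N => ∑ n ∈ Finset.range N, toSeq x n • unitVec 𝕜 r n) atTop (𝓝 x) := by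
  rw [Metric.tendsto_atTop]
  intro ε hε
  obtain ⟨y, hy⟩ := mem_tsirelsonSubmodule_iff.1 (toSeq_mem x) (ENNReal.ofReal ε)
    (ENNReal.ofReal_pos.2 hε)
  obtain ⟨M, hM⟩ := y.support.bddAbove
  obtain ⟨z, hz⟩ := exists_toSeq_eq (r := r) (coe_finsupp_mem y)
  refine ⟨M + 1, fun N hN => ?_⟩
  rw [dist_comm, dist_eq_norm]
  refine lt_of_le_of_lt (norm_le_norm_of_forall_le (y := x - z) fun n => ?_) ?_
  · rw [map_sub, map_sub, toSeq_sum_smul_unitVec]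
    by_cases hn : n < N
    · simp [Set.indicator, hn]
    · have : y n = 0 := by
        by_contra h0
        have := hM (Finset.mem_coe.2 (Finsupp.mem_support_iff.2 h0))
        omega
      simp [Set.indicator, hn, hz, this]
  · rw [← ENNReal.ofReal_lt_ofReal_iff hε, ofReal_norm, enorm_eq, map_sub, hz]
    exact hy

/-- A Cauchy sequence converges coordinatewise, and closedness of balls under coordinatewise limits
upgrades this to norm convergence. -/
instance [hr : Fact (0 < r)] : CompleteSpace (TsirelsonSpace 𝕜 r) := by
  have hp : 0 < min r 1 := lt_min hr.out one_pos
  refine Metric.complete_of_cauchySeq_tendsto fun u hu => ?_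
  rw [Metric.cauchySeq_iff] at hu
  have hcoord : ∀ n, ∃ t, Tendsto (fun k => toSeq (u k) n) atTop (𝓝 t) := by
    intro n
    refine cauchySeq_tendsto_of_complete (Metric.cauchySeq_iff.2 fun ε hε => ?_)
    obtain ⟨M, hM⟩ := hu (ε ^ min r 1) (Real.rpow_pos_of_pos hε _)
    refine ⟨M, fun k hk l hl => ?_⟩
    have h1 := hM k hk l hl
    rw [dist_eq_norm] at h1 ⊢
    have h2 := (norm_coord_rpow_le (u k - u l) n).trans_lt h1
    rw [map_sub] at h2
    exact (Real.rpow_lt_rpow_iff (norm_nonneg _) hε.le hp).1 h2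
  choose f hf using hcoord
  have hlim : ∀ ε : ℝ, 0 < ε → ∃ M, ∀ k ≥ M,
      convexifiedNorm r (f - toSeq (u k)) ^ min r 1 ≤ ENNReal.ofReal ε := by
    intro ε hε
    obtain ⟨M, hM⟩ := hu ε hε
    refine ⟨M, fun k hk => ?_⟩
    have ht : Tendsto (fun l => toSeq (u l) - toSeq (u k)) atTop (𝓝 (f - toSeq (u k))) :=
      (tendsto_pi_nhds.2 hf).sub_const _
    refine (isClosed_convexifiedNorm_rpow_le hr.out (ENNReal.ofReal ε)).mem_of_tendsto ht ?_
    filter_upwards [eventually_ge_atTop M] with l hl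
    rw [← map_sub, ← enorm_eq, ← ofReal_norm, ← dist_eq_norm]
    exact ENNReal.ofReal_le_ofReal (hM l hl k hk).le
  have hmem : f ∈ tsirelsonSubmodule 𝕜 r := by
    refine mem_tsirelsonSubmodule_iff.2 fun ε hε => ?_
    obtain ⟨δ, hδ, hδε⟩ := ENNReal.lt_iff_exists_real_btwn.1 (ENNReal.half_pos hε.ne')
    have hδ0 : 0 < δ := ENNReal.ofReal_pos.1 (hδε.1)
    obtain ⟨M, hM⟩ := hlim δ hδ0
    obtain ⟨y, hy⟩ := mem_tsirelsonSubmodule_iff.1 (toSeq_mem (u M)) (ε / 2)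
      (ENNReal.half_pos hε.ne')
    refine ⟨y, ?_⟩
    rw [← sub_add_sub_cancel f (toSeq (u M)) ⇑y]
    refine (convexifiedNorm_rpow_add_le hr.out _ _).trans_lt ?_
    rw [← ENNReal.add_halves ε]
    exact ENNReal.add_lt_add ((hM M le_rfl).trans_lt hδε.2) hy
  obtain ⟨z, hz⟩ := exists_toSeq_eq hmem
  refine ⟨z, Metric.tendsto_atTop.2 fun ε hε => ?_⟩
  obtain ⟨M, hM⟩ := hlim (ε / 2) (half_pos hε)
  refine ⟨M, fun k hk => ?_⟩
  rw [dist_comm, dist_eq_norm]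
  refine lt_of_le_of_lt ?_ (half_lt_self hε)
  rw [← ENNReal.ofReal_le_ofReal_iff (half_pos hε).le, ofReal_norm, enorm_eq, map_sub, hz]
  exact hM k hk

end TsirelsonSpace

/-! ### Subsymmetric sequences in spaces with a basis -/

/-- Counterexamples available arbitrarily far out are chosen one after another: the `k`-th beyond `N
k`, with `N (k + 1)` at least its cardinality. Then `n ∈ s` forces `k ≤ N k ≤ n`, so a single `θ`
with `N (n + 1) ≤ θ n` makes all of them few and far out. -/
theorem exists_strictMono_card_le {ι : Type*} {P : ℕ → Finset ℕ → ι → Prop}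
    (h : ∀ k N, ∃ s a, (∀ n ∈ s, N ≤ n) ∧ P k s a) :
    ∃ θ : ℕ → ℕ, StrictMono θ ∧ ∀ k, ∃ s a, P k s a ∧ ∀ n ∈ s, s.card ≤ θ n := by
  choose s a hs hP using h
  obtain ⟨N, hN⟩ : ∃ N : ℕ → ℕ, ∀ k, N (k + 1) = max ((s k (N k)).card) (N k + 1) :=
    ⟨fun j => Nat.rec 0 (fun k m => max ((s k m).card) (m + 1)) j, fun k => rfl⟩
  have hNm : StrictMono N := strictMono_nat_of_lt_succ fun k => by rw [hN]; omega
  refine ⟨fun n => n + N (n + 1), fun m n hmn => ?_, fun k => ⟨s k (N k), a k (N k), hP _ _, ?_⟩⟩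
  · have := hNm.monotone (show m + 1 ≤ n + 1 by omega)
    dsimp only
    omega
  · intro n hn
    have h1 := hs _ _ n hn
    have h2 := hNm.id_le k
    simp only [id] at h2
    have h3 := hNm.monotone (show k + 1 ≤ n + 1 by omega)
    rw [hN] at h3
    dsimp only
    omega

theorem exists_subseq_tendsto_coord {𝕜 : Type*} [RCLike 𝕜] {c : ℕ → ℕ → 𝕜} {b : ℕ → ℝ}
    (hb : ∀ n k, ‖c n k‖ ≤ b n) : ∃ φ : ℕ → ℕ, StrictMono φ ∧
      ∃ l : ℕ → 𝕜, ∀ n, Tendsto (fun k => c n (φ k)) atTop (𝓝 (l n)) := by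
  have hK : IsCompact (Set.univ.pi fun n => Metric.closedBall (0 : 𝕜) (b n)) :=
    isCompact_univ_pi fun n => isCompact_closedBall _ _
  obtain ⟨l, -, φ, hφ, hl⟩ := hK.tendsto_subseq (x := fun k n => c n k) fun k n _ => by
    simpa using hb n k
  exact ⟨φ, hφ, l, fun n => (tendsto_pi_nhds.1 hl) n⟩

section Subsymmetric

variable {𝕜 : Type*} [RCLike 𝕜] {E : Type*} [NormedAddCommGroup E] [Module 𝕜 E]
  {p : ℝ}

/-- The usual proof that continuity implies boundedness, for a `p`-homogeneous norm: the scaling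
factor is the `p`-th root of `δ / (2‖x‖)`. -/
theorem exists_norm_le_of_continuous (hp : 0 < p)
    (hsmul : ∀ (c : 𝕜) (x : E), ‖c • x‖ = ‖c‖ ^ p * ‖x‖) {F G : Submodule 𝕜 E} (T : F →L[𝕜] G) :
    ∃ C, 0 < C ∧ ∀ x : F, ‖(T x : E)‖ ≤ C * ‖(x : E)‖ := by
  have hc : ContinuousAt (fun x : F => (T x : E)) 0 :=
    (continuous_subtype_val.comp T.continuous).continuousAt
  obtain ⟨δ, hδ, h⟩ := Metric.continuousAt_iff.1 hc 1 one_pos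
  refine ⟨2 / δ, by positivity, fun x => ?_⟩
  rcases eq_or_ne x 0 with rfl | hx
  · simp
  have hx0 : 0 < ‖(x : E)‖ := norm_pos_iff.2 (by simpa using hx)
  set t : ℝ := (δ / 2 / ‖(x : E)‖) ^ p⁻¹ with ht
  have htp : ‖(t : 𝕜)‖ ^ p = δ / 2 / ‖(x : E)‖ := by
    rw [RCLike.norm_ofReal, abs_of_nonneg (by positivity), ht, ← Real.rpow_mul (by positivity),
      inv_mul_cancel₀ hp.ne', Real.rpow_one]
  have h1 : dist ((t : 𝕜) • x) 0 < δ := by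
    rw [Subtype.dist_eq, Submodule.coe_smul, Submodule.coe_zero, dist_zero_right, hsmul, htp,
      div_mul_cancel₀ _ hx0.ne']
    linarith
  have h2 := h h1
  rw [map_smul, map_zero, Submodule.coe_smul, Submodule.coe_zero, dist_zero_right, hsmul, htp,
    div_mul_eq_mul_div, div_lt_one hx0] at h2
  rw [div_mul_eq_mul_div, le_div_iff₀ hδ]
  linarith

/-- A zero term could carry any coefficient in an expansion of the zero vector. -/
theorem IsUnconditionalBasicSequence.ne_zero {x : ℕ → E}
    (hx : IsUnconditionalBasicSequence 𝕜 x) (n : ℕ) : x n ≠ 0 := by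
  classical
  intro h0
  have h := (hx 0 (subset_closure (Submodule.zero_mem _))).unique
    (y₁ := 0) (y₂ := Pi.single n 1) (by simp) ?_
  · have := congrFun h n
    simp at this
  · convert (hasSum_zero : HasSum (fun _ : ℕ => (0 : E)) 0) using 2 with m
    rcases eq_or_ne m n with rfl | hm
    · simp [h0]
    · simp [hm]

/-- A gliding hump: a coordinatewise null sequence has a subsequence close to blocks. -/
theorem exists_subseq_near_blocks {c : ℕ → E → 𝕜} {e : ℕ → E}
    (hsum : ∀ v, Tendsto (fun N => ∑ n ∈ Finset.range N, c n v • e n) atTop (𝓝 v))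
    (hp : 0 < p) (hsmul : ∀ (c : 𝕜) (x : E), ‖c • x‖ = ‖c‖ ^ p * ‖x‖)
    {y : ℕ → E} (hy : ∀ n, Tendsto (fun k => c n (y k)) atTop (𝓝 0)) {ε : ℕ → ℝ}
    (hε : ∀ k, 0 < ε k) :
    ∃ ψ N : ℕ → ℕ, StrictMono ψ ∧ StrictMono N ∧
      ∀ k, ‖y (ψ k) - ∑ n ∈ Finset.Ico (N k) (N (k + 1)), c n (y (ψ k)) • e n‖ ≤ ε k := by
  have hhead : ∀ N, Tendsto (fun k => ∑ n ∈ Finset.range N, c n (y k) • e n) atTop (𝓝 0) := by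
    intro N
    rw [← Finset.sum_const_zero (s := Finset.range N)]
    refine tendsto_finsetSum _ fun n _ => ?_
    rw [tendsto_zero_iff_norm_tendsto_zero]
    simp only [hsmul]
    have h1 := ((hy n).norm.rpow_const (p := p) (Or.inr hp.le)).mul_const ‖e n‖
    simpa [Real.zero_rpow hp.ne'] using h1
  -- A state `q` records the index of the last chosen term and the coordinate where its block ended.
  have hstep : ∀ (k : ℕ) (q : ℕ × ℕ), ∃ q' : ℕ × ℕ, q.1 < q'.1 ∧ q.2 < q'.2 ∧
      ‖∑ n ∈ Finset.range q.2, c n (y q'.1) • e n‖ < ε k / 2 ∧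
      ‖(∑ n ∈ Finset.range q'.2, c n (y q'.1) • e n) - y q'.1‖ < ε k / 2 := by
    intro k q
    have h1 := (tendsto_zero_iff_norm_tendsto_zero.1 (hhead q.2)).eventually
      (gt_mem_nhds (half_pos (hε k)))
    obtain ⟨m, hm, hqm⟩ := (h1.and (eventually_gt_atTop q.1)).exists
    have h2 := (tendsto_iff_norm_sub_tendsto_zero.1 (hsum (y m))).eventually
      (gt_mem_nhds (half_pos (hε k)))
    obtain ⟨N, hN, hqN⟩ := (h2.and (eventually_gt_atTop q.2)).exists
    exact ⟨(m, N), hqm, hqN, hm, hN⟩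
  choose F hF1 hF2 hF3 hF4 using hstep
  obtain ⟨q, hq⟩ : ∃ q : ℕ → ℕ × ℕ, ∀ k, q (k + 1) = F k (q k) :=
    ⟨fun j => Nat.rec (0, 0) (fun k m => F k m) j, fun k => rfl⟩
  refine ⟨fun k => (q (k + 1)).1, fun k => (q k).2, strictMono_nat_of_lt_succ fun k => ?_,
    strictMono_nat_of_lt_succ fun k => ?_, fun k => ?_⟩
  · rw [hq (k + 1)]
    exact hF1 _ _
  · rw [hq k]
    exact hF2 _ _
  · have h3 := hF3 k (q k)
    have h4 := hF4 k (q k)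
    have hle := (hF2 k (q k)).le
    rw [← hq] at h3 h4 hle
    rw [Finset.sum_Ico_eq_sub _ hle]
    set u := y (q (k + 1)).1
    set A := ∑ n ∈ Finset.range (q (k + 1)).2, c n u • e n
    set D := ∑ n ∈ Finset.range (q k).2, c n u • e n
    calc ‖u - (A - D)‖ = ‖D - (A - u)‖ := by congr 1; abel
      _ ≤ ‖D‖ + ‖A - u‖ := norm_sub_le _ _
      _ ≤ ε k := by linarith

/-! ### Consequences of subsymmetry. -/

variable [ContinuousConstSMul 𝕜 E]

/-- The spreading maps of a subsymmetric sequence, with two-sided bounds. -/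
theorem IsSubsymmetricBasicSequence.exists_spreading (hp : 0 < p)
    (hsmul : ∀ (c : 𝕜) (x : E), ‖c • x‖ = ‖c‖ ^ p * ‖x‖) {x : ℕ → E}
    (hx : IsSubsymmetricBasicSequence 𝕜 x) {φ : ℕ → ℕ} (hφ : StrictMono φ) :
    ∃ (T : closedSpan 𝕜 x →L[𝕜] E) (C : ℝ), 0 < C ∧
      (∀ n, T ⟨x n, mem_closedSpan 𝕜 x n⟩ = x (φ n)) ∧
      ∀ v, ‖T v‖ ≤ C * ‖(v : E)‖ ∧ ‖(v : E)‖ ≤ C * ‖T v‖ := by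
  obtain ⟨T, hT⟩ := hx.2 φ hφ
  obtain ⟨C, hC, h1⟩ := exists_norm_le_of_continuous hp hsmul T.toContinuousLinearMap
  obtain ⟨D, hD, h2⟩ := exists_norm_le_of_continuous hp hsmul T.symm.toContinuousLinearMap
  refine ⟨(closedSpan 𝕜 (x ∘ φ)).subtypeL.comp T.toContinuousLinearMap, max C D,
    lt_max_of_lt_left hC,
    fun n => ?_, fun v => ⟨(h1 v).trans ?_, ?_⟩⟩
  · simp [hT n]
  · gcongr
    exact le_max_left _ _
  · have h3 := h2 (T v)
    simp only [ContinuousLinearEquiv.coe_coe, ContinuousLinearEquiv.symm_apply_apply] at h3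
    refine h3.trans ?_
    simp only [ContinuousLinearMap.comp_apply, ContinuousLinearEquiv.coe_coe,
      Submodule.subtypeL_apply]
    gcongr
    exact le_max_right _ _

/-- Otherwise some subsequence has `‖x (φ n)‖ > n ‖x n‖`, which no bounded spreading map allows. The
next lemma uses the inverse map in the same way. -/
theorem IsSubsymmetricBasicSequence.exists_norm_le (hp : 0 < p)
    (hsmul : ∀ (c : 𝕜) (x : E), ‖c • x‖ = ‖c‖ ^ p * ‖x‖) {x : ℕ → E}
    (hx : IsSubsymmetricBasicSequence 𝕜 x) : ∃ B, ∀ n, ‖x n‖ ≤ B := by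
  suffices h : ∃ n : ℕ, ∀ᶠ k in atTop, ‖x k‖ ≤ n * ‖x n‖ by
    obtain ⟨n, hn⟩ := h
    obtain ⟨B, hB⟩ := (isBoundedUnder_of_eventually_le hn).bddAbove_range
    exact ⟨B, fun k => hB (Set.mem_range_self k)⟩
  by_contra! h
  obtain ⟨φ, hφ, hφ'⟩ := extraction_forall_of_frequently h
  obtain ⟨T, C, hC, hT, hb⟩ := hx.exists_spreading hp hsmul hφ
  obtain ⟨n, hn⟩ := exists_nat_ge C
  have h1 := (hb ⟨x n, mem_closedSpan 𝕜 x n⟩).1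
  rw [hT] at h1
  have h2 : C * ‖x n‖ ≤ n * ‖x n‖ := by gcongr
  exact absurd (h1.trans h2) (hφ' n).not_ge

theorem IsSubsymmetricBasicSequence.not_tendsto_zero (hp : 0 < p)
    (hsmul : ∀ (c : 𝕜) (x : E), ‖c • x‖ = ‖c‖ ^ p * ‖x‖) {x : ℕ → E}
    (hx : IsSubsymmetricBasicSequence 𝕜 x) : ¬ Tendsto x atTop (𝓝 0) := by
  intro h0
  have h : ∀ n : ℕ, ∃ᶠ k in atTop, n * ‖x k‖ < ‖x n‖ := by
    intro n
    have h1 : Tendsto (fun k => n * ‖x k‖) atTop (𝓝 (n * 0)) :=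
      (tendsto_zero_iff_norm_tendsto_zero.1 h0).const_mul _
    rw [mul_zero] at h1
    exact (h1.eventually (gt_mem_nhds (norm_pos_iff.2 (hx.1.ne_zero n)))).frequently
  obtain ⟨φ, hφ, hφ'⟩ := extraction_forall_of_frequently h
  obtain ⟨T, C, hC, hT, hb⟩ := hx.exists_spreading hp hsmul hφ
  obtain ⟨n, hn⟩ := exists_nat_ge C
  have h1 := (hb ⟨x n, mem_closedSpan 𝕜 x n⟩).2
  rw [hT] at h1
  have h2 : C * ‖x (φ n)‖ ≤ n * ‖x (φ n)‖ := by gcongr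
  exact absurd (h1.trans h2) (hφ' n).not_ge

/-- The right shift `x n ↦ x (n + 1)` would fix the limit `f`. Shifting the expansion of `f` and
using uniqueness makes every coefficient equal to its predecessor and the first one `0`; so `f = 0`,
which is already excluded. -/
theorem IsSubsymmetricBasicSequence.not_tendsto (hp : 0 < p)
    (hsmul : ∀ (c : 𝕜) (x : E), ‖c • x‖ = ‖c‖ ^ p * ‖x‖) {x : ℕ → E}
    (hx : IsSubsymmetricBasicSequence 𝕜 x) (f : E) : ¬ Tendsto x atTop (𝓝 f) := by
  intro hf
  have hmem : f ∈ closedSpan 𝕜 x :=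
    mem_closure_of_tendsto hf (Eventually.of_forall fun n =>
      Submodule.subset_span (Set.mem_range_self n))
  obtain ⟨T, C, hC, hT, hb⟩ := hx.exists_spreading hp hsmul (strictMono_id.add_const 1)
  have hTf : T ⟨f, hmem⟩ = f := by
    have h1 : Tendsto (fun n => (⟨x n, mem_closedSpan 𝕜 x n⟩ : closedSpan 𝕜 x)) atTop
        (𝓝 ⟨f, hmem⟩) := tendsto_subtype_rng.2 hf
    have h2 := (T.continuous.tendsto _).comp h1
    refine tendsto_nhds_unique h2 (((tendsto_add_atTop_iff_nat 1).2 hf).congr fun n => ?_)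
    exact (hT n).symm
  obtain ⟨a, ha, huniq⟩ := hx.1 f hmem
  have hS : HasSum (fun n => a n • x (n + 1)) f := by
    have h1 : HasSum (fun n => a n • (⟨x n, mem_closedSpan 𝕜 x n⟩ : closedSpan 𝕜 x))
        ⟨f, hmem⟩ := by
      refine (Topology.IsInducing.subtypeVal.hasSum_iff (g := (closedSpan 𝕜 x).subtype) _ _).1 ?_
      exact ha
    have h2 := T.hasSum h1
    simpa only [map_smul, hT, hTf, id] using h2
  have hb0 : HasSum (fun n => (Nat.casesOn n 0 a : 𝕜) • x n) f := by
    rw [← hasSum_nat_add_iff' 1]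
    simpa using hS
  have heq := huniq _ hb0
  have hz : ∀ n, a n = 0 := by
    intro n
    induction n with
    | zero => exact (congrFun heq 0).symm
    | succ n ih => exact (congrFun heq (n + 1)).symm.trans ih
  have hf0 : f = 0 := by
    simp only [hz, zero_smul] at ha
    exact ha.unique hasSum_zero
  exact hx.not_tendsto_zero hp hsmul (hf0 ▸ hf)

theorem IsSubsymmetricBasicSequence.not_tendsto_comp (hp : 0 < p)
    (hsmul : ∀ (c : 𝕜) (x : E), ‖c • x‖ = ‖c‖ ^ p * ‖x‖) {x : ℕ → E}
    (hx : IsSubsymmetricBasicSequence 𝕜 x) {φ : ℕ → ℕ} (hφ : StrictMono φ) (f : E) :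
    ¬ Tendsto (x ∘ φ) atTop (𝓝 f) := by
  intro hf
  obtain ⟨T, hT⟩ := hx.2 φ hφ
  have hmem : f ∈ closedSpan 𝕜 (x ∘ φ) :=
    mem_closure_of_tendsto hf (Eventually.of_forall fun n =>
      Submodule.subset_span (Set.mem_range_self n))
  refine hx.not_tendsto hp hsmul (T.symm ⟨f, hmem⟩ : E) ?_
  have h1 : Tendsto (fun n => (⟨(x ∘ φ) n, mem_closedSpan 𝕜 (x ∘ φ) n⟩ : closedSpan 𝕜 (x ∘ φ)))
      atTop (𝓝 ⟨f, hmem⟩) := tendsto_subtype_rng.2 hf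
  have h2 := (continuous_subtype_val.tendsto _).comp ((T.symm.continuous.tendsto _).comp h1)
  refine h2.congr fun n => ?_
  simp only [Function.comp_apply]
  have := hT n
  rw [← T.eq_symm_apply] at this
  exact (congrArg Subtype.val this).symm

/-- A subsymmetric sequence in a space with a basis produces a seminormalised sequence close to
a block sequence of the basis and equivalent to all its subsequences. -/
theorem IsSubsymmetricBasicSequence.exists_near_blocks [CompleteSpace E] (hp : 0 < p)
    (hsmul : ∀ (c : 𝕜) (x : E), ‖c • x‖ = ‖c‖ ^ p * ‖x‖) {c : ℕ → E →ₗ[𝕜] 𝕜} {e : ℕ → E}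
    (hc : ∀ n, ∃ b, ∀ v, ‖c n v‖ ^ p ≤ b * ‖v‖)
    (hsum : ∀ v, Tendsto (fun N => ∑ n ∈ Finset.range N, c n v • e n) atTop (𝓝 v))
    {x : ℕ → E} (hx : IsSubsymmetricBasicSequence 𝕜 x) {η : ℝ} (hη : 0 < η) :
    ∃ (y : ℕ → E) (δ B : ℝ) (N : ℕ → ℕ), 0 < δ ∧ StrictMono N ∧ (∀ k, δ ≤ ‖y k‖) ∧
      (∀ k, ‖y k‖ ≤ B) ∧
      (∀ θ : ℕ → ℕ, StrictMono θ → ∃ C, 0 < C ∧ ∀ (s : Finset ℕ) (a : ℕ → 𝕜),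
        ‖∑ k ∈ s, a k • y (θ k)‖ ≤ C * ‖∑ k ∈ s, a k • y k‖ ∧
        ‖∑ k ∈ s, a k • y k‖ ≤ C * ‖∑ k ∈ s, a k • y (θ k)‖) ∧
      ∀ k, ‖y k - ∑ n ∈ Finset.Ico (N k) (N (k + 1)), c n (y k) • e n‖ ≤
        δ * η * (1 / 2) ^ k := by
  obtain ⟨B, hB⟩ := hx.exists_norm_le hp hsmul
  choose b hb using hc
  have hcb : ∀ n k, ‖c n (x k)‖ ≤ (|b n| * B) ^ p⁻¹ := by
    intro n k
    have hB0 : 0 ≤ B := (norm_nonneg _).trans (hB 0)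
    rw [Real.le_rpow_inv_iff_of_pos (norm_nonneg _) (by positivity) hp]
    refine (hb n (x k)).trans ?_
    exact mul_le_mul (le_abs_self _) (hB k) (norm_nonneg _) (abs_nonneg _)
  obtain ⟨φ, hφ, l, hl⟩ := exists_subseq_tendsto_coord (c := fun n k => c n (x k)) hcb
  have hnc : ¬ CauchySeq (x ∘ φ) := fun h =>
    let ⟨f, hf⟩ := cauchySeq_tendsto_of_complete h
    hx.not_tendsto_comp hp hsmul hφ f hf
  rw [Metric.cauchySeq_iff'] at hnc
  push Not at hnc
  obtain ⟨δ, hδ, hfar⟩ := hnc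
  choose g hg1 hg2 using hfar
  have hg : ∀ m, m < g m := by
    intro m
    refine lt_of_le_of_ne (hg1 m) fun h => ?_
    have := hg2 m
    rw [← h, dist_self] at this
    linarith
  -- The index pairs `m k < g (m k)` are successive and disjoint, and the terms in each pair are
  -- `δ`-separated; taking differences removes the coordinatewise limit `l`.
  obtain ⟨m, hm⟩ : ∃ m : ℕ → ℕ, ∀ k, m (k + 1) = g (m k) + 1 :=
    ⟨fun j => Nat.rec 0 (fun _ i => g i + 1) j, fun k => rfl⟩
  have hmm : StrictMono m := strictMono_nat_of_lt_succ fun k => by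
    have := hg (m k)
    rw [hm]
    omega
  let y₀ : ℕ → E := fun k => x (φ (m k)) - x (φ (g (m k)))
  have hgm : Tendsto (fun k => g (m k)) atTop atTop :=
    tendsto_atTop_mono (fun k => hg1 (m k)) hmm.tendsto_atTop
  have hy₀ : ∀ n, Tendsto (fun k => c n (y₀ k)) atTop (𝓝 0) := by
    intro n
    have := ((hl n).comp hmm.tendsto_atTop).sub ((hl n).comp hgm)
    simpa [y₀] using this
  have hy₀δ : ∀ k, δ ≤ ‖y₀ k‖ := fun k => by
    have := hg2 (m k)
    rwa [dist_comm, dist_eq_norm] at this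
  obtain ⟨ψ, N, hψ, hN, hblock⟩ := exists_subseq_near_blocks hsum hp hsmul hy₀
    (ε := fun k => δ * η * (1 / 2) ^ k) fun k => by positivity
  -- every subsequence of `y₀` is equivalent to the differences `x (2k) - x (2k+1)`
  have hequiv : ∀ θ : ℕ → ℕ, StrictMono θ → ∃ C, 0 < C ∧ ∀ (s : Finset ℕ) (a : ℕ → 𝕜),
      ‖∑ k ∈ s, a k • y₀ (θ k)‖ ≤ C * ‖∑ k ∈ s, a k • (x (2 * k) - x (2 * k + 1))‖ ∧
      ‖∑ k ∈ s, a k • (x (2 * k) - x (2 * k + 1))‖ ≤ C * ‖∑ k ∈ s, a k • y₀ (θ k)‖ := by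
    intro θ hθ
    -- Interleaving both members of each pair gives one subsequence of `x`, whose spreading map
    -- carries `x (2k) - x (2k+1)` to `y₀ (θ k)`.
    let σ : ℕ → ℕ := fun n => if n % 2 = 0 then φ (m (θ (n / 2))) else φ (g (m (θ (n / 2))))
    have hσ0 : ∀ k, σ (2 * k) = φ (m (θ k)) := fun k => by simp [σ]
    have hσ1 : ∀ k, σ (2 * k + 1) = φ (g (m (θ k))) := fun k => by
      have h1 : (2 * k + 1) % 2 = 1 := by omega
      have h2 : (2 * k + 1) / 2 = k := by omega
      simp [σ, h1, h2]
    have hσ : StrictMono σ := by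
      refine strictMono_nat_of_lt_succ fun n => ?_
      obtain ⟨k, rfl | rfl⟩ : ∃ k, n = 2 * k ∨ n = 2 * k + 1 := ⟨n / 2, by omega⟩
      · rw [hσ0, hσ1]
        exact hφ (hg _)
      · rw [hσ1, show 2 * k + 1 + 1 = 2 * (k + 1) by ring, hσ0]
        refine hφ (lt_of_lt_of_le (Nat.lt_succ_self _) ?_)
        rw [Nat.succ_eq_add_one, ← hm]
        exact hmm.monotone (hθ (Nat.lt_succ_self k))
    obtain ⟨T, C, hC, hT, hTC⟩ := hx.exists_spreading hp hsmul hσ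
    refine ⟨C, hC, fun s a => ?_⟩
    let d : ℕ → closedSpan 𝕜 x := fun k =>
      ⟨x (2 * k), mem_closedSpan 𝕜 x _⟩ - ⟨x (2 * k + 1), mem_closedSpan 𝕜 x _⟩
    have h1 := hTC (∑ k ∈ s, a k • d k)
    have h2 : T (∑ k ∈ s, a k • d k) = ∑ k ∈ s, a k • y₀ (θ k) := by
      simp [d, hT, hσ0, hσ1, y₀]
    have h3 : ((∑ k ∈ s, a k • d k : closedSpan 𝕜 x) : E) =
        ∑ k ∈ s, a k • (x (2 * k) - x (2 * k + 1)) := by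
      simp [d]
    rwa [h2, h3] at h1
  refine ⟨y₀ ∘ ψ, δ, B + B, N, hδ, hN, fun k => hy₀δ _, fun k =>
    (norm_sub_le _ _).trans (add_le_add (hB _) (hB _)), fun θ hθ => ?_, hblock⟩
  obtain ⟨C, hC, h1⟩ := hequiv (ψ ∘ θ) (hψ.comp hθ)
  obtain ⟨D, hD, h2⟩ := hequiv ψ hψ
  refine ⟨C * D, by positivity, fun s a => ⟨?_, ?_⟩⟩
  · rw [mul_assoc]
    exact (h1 s a).1.trans (mul_le_mul_of_nonneg_left (h2 s a).2 hC.le)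
  · rw [mul_comm C D, mul_assoc]
    exact (h2 s a).1.trans (mul_le_mul_of_nonneg_left (h1 s a).2 hD.le)

end Subsymmetric

/-! ### Block sequences of `T^(r)` -/

theorem sum_half_pow_le {s : Finset ℕ} {K : ℕ} (hs : ∀ n ∈ s, K ≤ n) :
    ∑ n ∈ s, (1 / 2 : ℝ) ^ n ≤ 2 * (1 / 2) ^ K := by
  have hinj : Set.InjOn (fun n => n - K) (s : Set ℕ) := by
    intro a ha b hb hab
    have := hs a ha
    have := hs b hb
    simp only at hab
    omega
  calc ∑ n ∈ s, (1 / 2 : ℝ) ^ n = ∑ n ∈ s, (1 / 2 : ℝ) ^ K * (1 / 2) ^ (n - K) := by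
        refine Finset.sum_congr rfl fun n hn => ?_
        rw [← pow_add, Nat.add_sub_cancel' (hs n hn)]
    _ = (1 / 2 : ℝ) ^ K * ∑ m ∈ s.image fun n => n - K, (1 / 2 : ℝ) ^ m := by
        rw [Finset.sum_image hinj, Finset.mul_sum]
    _ ≤ (1 / 2 : ℝ) ^ K * 2 := by
        gcongr
        exact (summable_geometric_two.sum_le_tsum _ fun _ _ => by positivity).trans_eq
          tsum_geometric_two
    _ = _ := mul_comm _ _

/-- Transfers estimates between the sequence and its blocks. Since `n ≤ θ n`, the errors stay
geometric along subsequences; the gain `(1/2)^K` is needed when the combination itself is small. -/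
theorem norm_sum_smul_sub_le {𝕜 : Type*} [RCLike 𝕜] {E : Type*} [NormedAddCommGroup E]
    [Module 𝕜 E] {p : ℝ} (hp : 0 < p) (hsmul : ∀ (c : 𝕜) (x : E), ‖c • x‖ = ‖c‖ ^ p * ‖x‖)
    {y z : ℕ → E} {ε : ℝ} (hyz : ∀ k, ‖y k - z k‖ ≤ ε * (1 / 2) ^ k) {θ : ℕ → ℕ}
    (hθ : StrictMono θ) {s : Finset ℕ} {K : ℕ} (hs : ∀ n ∈ s, K ≤ n) {a : ℕ → 𝕜}
    (ha : ∀ n ∈ s, ‖a n‖ ≤ 1) :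
    ‖∑ n ∈ s, a n • y (θ n) - ∑ n ∈ s, a n • z (θ n)‖ ≤ 2 * ε * (1 / 2) ^ K := by
  have hε : 0 ≤ ε := by simpa using (norm_nonneg _).trans (hyz 0)
  calc ‖∑ n ∈ s, a n • y (θ n) - ∑ n ∈ s, a n • z (θ n)‖
      = ‖∑ n ∈ s, a n • (y (θ n) - z (θ n))‖ := by
        simp only [smul_sub, Finset.sum_sub_distrib]
    _ ≤ ∑ n ∈ s, ‖a n • (y (θ n) - z (θ n))‖ := norm_sum_le _ _
    _ ≤ ∑ n ∈ s, ε * (1 / 2) ^ n := by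
        refine Finset.sum_le_sum fun n hn => ?_
        rw [hsmul]
        have h1 : ‖a n‖ ^ p ≤ 1 := Real.rpow_le_one (norm_nonneg _) (ha n hn) hp.le
        have h2 : ((1 : ℝ) / 2) ^ θ n ≤ (1 / 2) ^ n :=
          pow_le_pow_of_le_one (by norm_num) (by norm_num) (hθ.id_le n)
        calc ‖a n‖ ^ p * ‖y (θ n) - z (θ n)‖ ≤ 1 * (ε * (1 / 2) ^ n) :=
              mul_le_mul h1 ((hyz _).trans (mul_le_mul_of_nonneg_left h2 hε)) (norm_nonneg _)
                zero_le_one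
          _ = _ := one_mul _
    _ ≤ 2 * ε * (1 / 2) ^ K := by
        rw [← Finset.mul_sum]
        have := mul_le_mul_of_nonneg_left (sum_half_pow_le hs) hε
        linarith

theorem enorm_sum_rpow_of_subsingleton {𝕜 : Type*} [RCLike 𝕜] {r : ℝ} (hr : 0 < r)
    {s : Finset ℕ} {f : ℕ → 𝕜} (h : ∀ i ∈ s, ∀ j ∈ s, f i ≠ 0 → f j ≠ 0 → i = j) :
    ‖∑ i ∈ s, f i‖ₑ ^ r = ∑ i ∈ s, ‖f i‖ₑ ^ r := by
  by_cases hex : ∃ i ∈ s, f i ≠ 0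
  · obtain ⟨i, hi, hfi⟩ := hex
    have h0 : ∀ j ∈ s, j ≠ i → f j = 0 := fun j hj hji => by
      by_contra hfj
      exact hji (h j hj i hi hfj hfi)
    rw [Finset.sum_eq_single_of_mem i hi h0, Finset.sum_eq_single_of_mem i hi]
    intro j hj hji
    simp [h0 j hj hji, hr]
  · push Not at hex
    rw [Finset.sum_eq_zero hex, Finset.sum_eq_zero fun i hi => by simp [hex i hi, hr]]
    simp [hr]

theorem sum_tsirelsonNorm_Ico_comp_le {N : ℕ → ℕ} (hN : StrictMono N) {θ : ℕ → ℕ}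
    (hθ : StrictMono θ) (s : Finset ℕ) (hs : ∀ k ∈ s, s.card ≤ θ k) (x : ℕ → ℝ≥0∞) :
    (∑ k ∈ s, tsirelsonNorm ((Set.Ico (N (θ k)) (N (θ k + 1))).indicator x)) / 2 ≤
      tsirelsonNorm x := by
  have h := sum_tsirelsonNorm_Ico_le hN (s.image θ) (fun k hk => ?_) x
  · rwa [Finset.sum_image hθ.injective.injOn] at h
  · obtain ⟨n, hn, rfl⟩ := Finset.mem_image.1 hk
    exact Finset.card_image_le.trans (hs n hn)

namespace TsirelsonSpace

variable {𝕜 : Type*} [RCLike 𝕜] {r : ℝ}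

theorem eq_of_block_ne_zero [Fact (0 < r)] {N : ℕ → ℕ} (hN : StrictMono N)
    {z : ℕ → TsirelsonSpace 𝕜 r}
    (hz : ∀ k n, toSeq (z k) n ≠ 0 → n ∈ Set.Ico (N k) (N (k + 1))) {i j n : ℕ}
    (hi : toSeq (z i) n ≠ 0) (hj : toSeq (z j) n ≠ 0) : i = j := by
  have h1 := hz i n hi
  have h2 := hz j n hj
  rw [Set.mem_Ico] at h1 h2
  rcases lt_trichotomy i j with h | h | h
  · have := hN.monotone (Nat.succ_le_of_lt h)
    simp only [Nat.succ_eq_add_one] at this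
    omega
  · exact h
  · have := hN.monotone (Nat.succ_le_of_lt h)
    simp only [Nat.succ_eq_add_one] at this
    omega

/-- The lower `ℓ_r` estimate for few far out blocks. -/
theorem sum_norm_rpow_le_norm_sum_blocks [hr : Fact (0 < r)] {N : ℕ → ℕ} (hN : StrictMono N)
    {z : ℕ → TsirelsonSpace 𝕜 r}
    (hz : ∀ k n, toSeq (z k) n ≠ 0 → n ∈ Set.Ico (N k) (N (k + 1))) {θ : ℕ → ℕ}
    (hθ : StrictMono θ) (s : Finset ℕ) (hs : ∀ k ∈ s, s.card ≤ θ k) (a : ℕ → 𝕜) :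
    (∑ k ∈ s, ‖a k • z (θ k)‖ ^ (r / min r 1)) / 2 ≤
      ‖∑ k ∈ s, a k • z (θ k)‖ ^ (r / min r 1) := by
  have hp : 0 < min r 1 := lt_min hr.out one_pos
  have hq : 0 ≤ r / min r 1 := (div_pos hr.out hp).le
  have h := sum_tsirelsonNorm_Ico_comp_le hN hθ s hs
    fun n => ‖toSeq (∑ k ∈ s, a k • z (θ k)) n‖ₑ ^ r
  rw [tsirelsonNorm_eq_enorm] at h
  have h1 : ∀ k ∈ s, (Set.Ico (N (θ k)) (N (θ k + 1))).indicator
      (fun n => ‖toSeq (∑ k ∈ s, a k • z (θ k)) n‖ₑ ^ r) =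
        fun n => ‖toSeq (a k • z (θ k)) n‖ₑ ^ r := by
    intro k hk
    ext n
    by_cases hn : n ∈ Set.Ico (N (θ k)) (N (θ k + 1))
    · rw [Set.indicator_of_mem hn, map_sum, Finset.sum_apply, Finset.sum_eq_single_of_mem k hk]
      intro j hj hjk
      rw [map_smul, Pi.smul_apply]
      by_cases h0 : toSeq (z (θ j)) n = 0
      · rw [h0, smul_zero]
      · exfalso
        have h2 := hz _ n h0
        rw [Set.mem_Ico] at hn h2
        rcases lt_or_gt_of_ne hjk with h | h
        · have := hN.monotone (Nat.succ_le_of_lt (hθ h))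
          simp only [Nat.succ_eq_add_one] at this
          omega
        · have := hN.monotone (Nat.succ_le_of_lt (hθ h))
          simp only [Nat.succ_eq_add_one] at this
          omega
    · rw [Set.indicator_of_notMem hn]
      have h0 : toSeq (z (θ k)) n = 0 := by
        by_contra h0
        exact hn (hz _ n h0)
      simp [h0, hr.out]
  rw [Finset.sum_congr rfl fun k hk => by rw [h1 k hk, tsirelsonNorm_eq_enorm]] at h
  have h3 : ∀ v : TsirelsonSpace 𝕜 r,
      ‖v‖ₑ ^ (r / min r 1) = ENNReal.ofReal (‖v‖ ^ (r / min r 1)) := fun v => by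
    rw [← ofReal_norm, ENNReal.ofReal_rpow_of_nonneg (norm_nonneg _) hq]
  simp only [h3] at h
  rw [← ENNReal.ofReal_sum_of_nonneg fun k _ => by positivity, ← ENNReal.ofReal_ofNat 2,
    ← ENNReal.ofReal_div_of_pos two_pos, ENNReal.ofReal_le_ofReal_iff (by positivity)] at h
  exact h

/-- No bounded block sequence of `T^(r)` admits a lower `ℓ_r` estimate on a tail. -/
theorem exists_norm_sum_blocks_lt [hr : Fact (0 < r)] {N : ℕ → ℕ} (hN : StrictMono N)
    {z : ℕ → TsirelsonSpace 𝕜 r}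
    (hz : ∀ k n, toSeq (z k) n ≠ 0 → n ∈ Set.Ico (N k) (N (k + 1))) {B : ℝ}
    (hB : ∀ k, ‖z k‖ ≤ B) (K : ℕ) {c : ℝ} (hc : 0 < c) :
    ∃ (s : Finset ℕ) (a : ℕ → ℝ≥0), (∀ k ∈ s, K ≤ k) ∧ ∑ k ∈ s, a k = 1 ∧
      ‖∑ k ∈ s, (((a k : ℝ) ^ (1 / r) : ℝ) : 𝕜) • z k‖ < c := by
  have hp : 0 < min r 1 := lt_min hr.out one_pos
  have hq : 0 < r / min r 1 := div_pos hr.out hp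
  have hB' : ∀ k, (tsirelsonNorm fun n => ‖toSeq (z k) n‖ₑ ^ r) ≤
      ENNReal.ofReal B ^ (r / min r 1) := by
    intro k
    rw [tsirelsonNorm_eq_enorm, ← ofReal_norm]
    exact ENNReal.rpow_le_rpow (ENNReal.ofReal_le_ofReal (hB k)) hq.le
  obtain ⟨s, a, hsK, ha, h⟩ := exists_convex_combination_tsirelsonNorm_lt hN
    (fun k n hn => hz k n fun h0 => by simp [h0, hr.out] at hn)
    (ENNReal.rpow_ne_top_of_nonneg hq.le ENNReal.ofReal_ne_top) hB' K
    (ENNReal.rpow_pos_of_nonneg (ENNReal.ofReal_pos.2 hc) hq.le)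
  refine ⟨s, a, hsK, ha, ?_⟩
  -- By disjointness of supports, coefficients `a k ^ (1/r)` turn into the convex weights `a k` on
  -- the `r`-th powers of the moduli.
  have h1 : (∑ k ∈ s, a k • fun n => ‖toSeq (z k) n‖ₑ ^ r) =
      fun n => ‖toSeq (∑ k ∈ s, (((a k : ℝ) ^ (1 / r) : ℝ) : 𝕜) • z k) n‖ₑ ^ r := by
    ext n
    simp only [map_sum, Finset.sum_apply]
    rw [enorm_sum_rpow_of_subsingleton hr.out]
    · refine Finset.sum_congr rfl fun k _ => ?_
      rw [map_smul, Pi.smul_apply, Pi.smul_apply, enorm_smul,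
        ENNReal.mul_rpow_of_nonneg _ _ hr.out.le, ENNReal.smul_def, smul_eq_mul]
      congr 1
      rw [← ofReal_norm, RCLike.norm_ofReal, abs_of_nonneg (by positivity),
        ENNReal.ofReal_rpow_of_nonneg (by positivity) hr.out.le, ← Real.rpow_mul (by positivity),
        one_div_mul_cancel hr.out.ne', Real.rpow_one, ENNReal.ofReal_coe_nnreal]
    · intro i _ j _ hi hj
      refine eq_of_block_ne_zero hN hz (n := n) (fun h0 => hi ?_) fun h0 => hj ?_
      · rw [map_smul, Pi.smul_apply, h0, smul_zero]
      · rw [map_smul, Pi.smul_apply, h0, smul_zero]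
  rw [h1, tsirelsonNorm_eq_enorm, ENNReal.rpow_lt_rpow_iff hq, ← ofReal_norm,
    ENNReal.ofReal_lt_ofReal_iff hc] at h
  exact h

theorem not_isSubsymmetricBasicSequence [hr : Fact (0 < r)] (x : ℕ → TsirelsonSpace 𝕜 r) :
    ¬ IsSubsymmetricBasicSequence 𝕜 x := by
  intro hx
  have hp : 0 < min r 1 := lt_min hr.out one_pos
  have hq : 0 < r / min r 1 := div_pos hr.out hp
  -- `ρ` is the root of the factor `1/2` in the lower estimate. With `η = ρ/8` the total error is at
  -- most `δρ/4`, half of the bound `δρ/2` for the blocks.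
  set ρ : ℝ := (1 / 2) ^ (r / min r 1)⁻¹ with hρ
  have hρ0 : 0 < ρ := by positivity
  have hρ1 : ρ ≤ 1 := Real.rpow_le_one (by norm_num) (by norm_num) (inv_nonneg.2 hq.le)
  obtain ⟨y, δ, B, N, hδ, hN, hyδ, hyB, hyθ, hblock⟩ := hx.exists_near_blocks hp norm_smul_eq
    (c := fun n => (LinearMap.proj n).comp toSeq) (e := unitVec 𝕜 r)
    (fun n => ⟨1, fun v => by simpa using norm_coord_rpow_le v n⟩) tendsto_sum_unitVec
    (η := ρ / 8) (by positivity)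
  set z : ℕ → TsirelsonSpace 𝕜 r := fun k =>
    ∑ n ∈ Finset.Ico (N k) (N (k + 1)), toSeq (y k) n • unitVec 𝕜 r n with hzdef
  have hzseq : ∀ k, toSeq (z k) = (Set.Ico (N k) (N (k + 1))).indicator (toSeq (y k)) := by
    intro k
    rw [hzdef, toSeq_sum_smul_unitVec, Finset.coe_Ico]
  have hz : ∀ k n, toSeq (z k) n ≠ 0 → n ∈ Set.Ico (N k) (N (k + 1)) := by
    intro k n hn
    rw [hzseq] at hn
    exact Set.mem_of_indicator_ne_zero hn
  have hzB : ∀ k, ‖z k‖ ≤ B := by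
    intro k
    refine (norm_le_norm_of_forall_le fun n => ?_).trans (hyB k)
    rw [hzseq]
    exact norm_indicator_le_norm_self _ _
  have hyz : ∀ k, ‖y k - z k‖ ≤ δ * (ρ / 8) * (1 / 2) ^ k := hblock
  have hzδ : ∀ k, δ / 2 ≤ ‖z k‖ := by
    intro k
    have h1 := norm_sub_norm_le (y k) (z k)
    have h2 := hyz k
    have h3 : ((1 : ℝ) / 2) ^ k ≤ 1 := pow_le_one₀ (by norm_num) (by norm_num)
    have h4 : δ * (ρ / 8) * (1 / 2) ^ k ≤ δ / 2 := by
      calc δ * (ρ / 8) * (1 / 2) ^ k ≤ δ * (1 / 8) * 1 := by gcongr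
        _ ≤ δ / 2 := by linarith
    have h5 := hyδ k
    linarith
  have ha1 : ∀ (s : Finset ℕ) (a : ℕ → 𝕜), ∑ n ∈ s, ‖a n‖ ^ r = 1 → ∀ n ∈ s, ‖a n‖ ≤ 1 := by
    intro s a ha n hn
    have h1 : ‖a n‖ ^ r ≤ 1 := ha ▸ Finset.single_le_sum (f := fun n => ‖a n‖ ^ r)
      (fun i _ => by positivity) hn
    by_contra! h2
    exact absurd (Real.one_lt_rpow h2 hr.out) h1.not_gt
  -- the lower estimate for few far out terms
  have hfew : ∀ θ : ℕ → ℕ, StrictMono θ → ∀ (s : Finset ℕ) (a : ℕ → 𝕜),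
      ∑ n ∈ s, ‖a n‖ ^ r = 1 → (∀ n ∈ s, s.card ≤ θ n) →
      δ * ρ / 4 ≤ ‖∑ n ∈ s, a n • y (θ n)‖ := by
    intro θ hθ s a ha hs
    have h1 := norm_sum_smul_sub_le hp norm_smul_eq hyz hθ (s := s) (K := 0)
      (fun _ _ => Nat.zero_le _) (ha1 s a ha)
    have h2 : ρ * (δ / 2) ≤ ‖∑ n ∈ s, a n • z (θ n)‖ := by
      rw [← Real.rpow_le_rpow_iff (by positivity) (norm_nonneg _) hq]
      refine le_trans ?_ (sum_norm_rpow_le_norm_sum_blocks hN hz hθ s hs a)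
      rw [Real.mul_rpow hρ0.le (by positivity), hρ, ← Real.rpow_mul (by norm_num),
        inv_mul_cancel₀ hq.ne', Real.rpow_one, one_div_mul_eq_div]
      gcongr
      calc (δ / 2) ^ (r / min r 1) = ∑ n ∈ s, ‖a n‖ ^ r * (δ / 2) ^ (r / min r 1) := by
            rw [← Finset.sum_mul, ha, one_mul]
        _ ≤ ∑ n ∈ s, ‖a n • z (θ n)‖ ^ (r / min r 1) := by
            refine Finset.sum_le_sum fun n _ => ?_
            rw [norm_smul_eq, Real.mul_rpow (by positivity) (norm_nonneg _),
              ← Real.rpow_mul (norm_nonneg _), mul_div_cancel₀ _ hp.ne']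
            gcongr
            exact hzδ _
    have h3 := norm_sub_norm_le (∑ n ∈ s, a n • z (θ n)) (∑ n ∈ s, a n • y (θ n))
    rw [norm_sub_rev] at h3
    rw [pow_zero] at h1
    linarith
  -- hence a lower estimate on a tail
  have htail : ∃ (K : ℕ) (c : ℝ), 0 < c ∧ ∀ (s : Finset ℕ) (a : ℕ → 𝕜), (∀ n ∈ s, K ≤ n) →
      ∑ n ∈ s, ‖a n‖ ^ r = 1 → c ≤ ‖∑ n ∈ s, a n • y n‖ := by
    by_contra! hcon
    -- Without a tail estimate, one `θ` spreads all violating combinations so that `hfew` applies;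
    -- the equivalence constant for this `θ` bounds their norms below.
    obtain ⟨θ, hθ, hbad⟩ := exists_strictMono_card_le
      (P := fun k s (a : ℕ → 𝕜) => ∑ n ∈ s, ‖a n‖ ^ r = 1 ∧ ‖∑ n ∈ s, a n • y n‖ < 1 / (k + 1))
      fun k K => by
        obtain ⟨s, a, h1, h2, h3⟩ := hcon K (1 / (k + 1)) (by positivity)
        exact ⟨s, a, h1, h2, h3⟩
    obtain ⟨C, hC, hCθ⟩ := hyθ θ hθ
    obtain ⟨k, hk⟩ := exists_nat_one_div_lt (show 0 < δ * ρ / 4 / C by positivity)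
    obtain ⟨s, a, ⟨has, hay⟩, hcard⟩ := hbad k
    have h1 := hfew θ hθ s a has hcard
    have h2 := (hCθ s a).1
    have h3 : C * ‖∑ n ∈ s, a n • y n‖ < C * (δ * ρ / 4 / C) :=
      mul_lt_mul_of_pos_left (hay.trans hk) hC
    rw [mul_div_cancel₀ _ hC.ne'] at h3
    linarith
  obtain ⟨K₀, c, hc, hlow⟩ := htail
  have hlim : Tendsto (fun K : ℕ => 2 * (δ * (ρ / 8)) * (1 / 2 : ℝ) ^ K) atTop (𝓝 0) := by
    simpa using (tendsto_pow_atTop_nhds_zero_of_lt_one (r := (1 / 2 : ℝ)) (by norm_num)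
      (by norm_num)).const_mul (2 * (δ * (ρ / 8)))
  -- Far enough out the error is below `c/2`, leaving room for a block combination of norm below
  -- `c/2`.
  obtain ⟨K, hKc, hK⟩ :=
    ((hlim.eventually (gt_mem_nhds (half_pos hc))).and (eventually_ge_atTop K₀)).exists
  obtain ⟨s, α, hsK, hα, hsmall⟩ := exists_norm_sum_blocks_lt hN hz hzB K (half_pos hc)
  have ha : ∑ n ∈ s, ‖(((α n : ℝ) ^ (1 / r) : ℝ) : 𝕜)‖ ^ r = 1 := by
    have hα' : ∑ n ∈ s, (α n : ℝ) = 1 := by exact_mod_cast hα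
    refine (Finset.sum_congr rfl fun n _ => ?_).trans hα'
    rw [RCLike.norm_ofReal, abs_of_nonneg (by positivity), ← Real.rpow_mul (by positivity),
      one_div_mul_cancel hr.out.ne', Real.rpow_one]
  have h1 := hlow s _ (fun n hn => hK.trans (hsK n hn)) ha
  have h2 := norm_sum_smul_sub_le hp norm_smul_eq hyz strictMono_id hsK (ha1 s _ ha)
  simp only [id] at h2
  have h3 := norm_sub_norm_le (∑ n ∈ s, (((α n : ℝ) ^ (1 / r) : ℝ) : 𝕜) • y n)
    (∑ n ∈ s, (((α n : ℝ) ^ (1 / r) : ℝ) : 𝕜) • z n)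
  linarith

end TsirelsonSpace

/-! ### The dual of `T^(r)` -/

namespace TsirelsonSpace

variable {𝕜 : Type*} [RCLike 𝕜] {r : ℝ}

/-- The restriction of a vector to a finite set of coordinates. -/
noncomputable def restrict [Fact (0 < r)] (I : Finset ℕ) (x : TsirelsonSpace 𝕜 r) :
    TsirelsonSpace 𝕜 r :=
  ∑ n ∈ I, toSeq x n • unitVec 𝕜 r n

theorem toSeq_restrict [Fact (0 < r)] (I : Finset ℕ) (x : TsirelsonSpace 𝕜 r) :
    toSeq (restrict I x) = (I : Set ℕ).indicator (toSeq x) :=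
  toSeq_sum_smul_unitVec I _

theorem norm_restrict_le [Fact (0 < r)] (I : Finset ℕ) (x : TsirelsonSpace 𝕜 r) :
    ‖restrict I x‖ ≤ ‖x‖ :=
  norm_le_norm_of_forall_le fun n => by
    rw [toSeq_restrict]
    exact norm_indicator_le_norm_self _ _

theorem tsirelsonNorm_eq_enorm_rpow [h : Fact (1 ≤ r)] (x : TsirelsonSpace 𝕜 r) :
    (tsirelsonNorm fun n => ‖toSeq x n‖ₑ ^ r) = ‖x‖ₑ ^ r := by
  rw [tsirelsonNorm_eq_enorm, min_eq_right h.out, div_one]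

/-- The coordinate functionals. -/
noncomputable def coord (𝕜 : Type*) [RCLike 𝕜] (r : ℝ) [Fact (1 ≤ r)] (n : ℕ) :
    StrongDual 𝕜 (TsirelsonSpace 𝕜 r) :=
  LinearMap.mkContinuous ((LinearMap.proj n).comp toSeq) 1 fun x => by
    have h : Fact (1 ≤ r) := inferInstance
    simpa [min_eq_right h.out] using norm_coord_rpow_le x n

theorem coord_apply [Fact (1 ≤ r)] (n : ℕ) (x : TsirelsonSpace 𝕜 r) :
    coord 𝕜 r n x = toSeq x n := rfl

theorem sum_smul_coord_apply [Fact (1 ≤ r)] (f : StrongDual 𝕜 (TsirelsonSpace 𝕜 r))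
    (I : Finset ℕ) (x : TsirelsonSpace 𝕜 r) :
    (∑ n ∈ I, f (unitVec 𝕜 r n) • coord 𝕜 r n) x = f (restrict I x) := by
  simp [restrict, coord_apply, mul_comm]

/-- A functional on `T^(r)` is small on vectors with supports far out. -/
theorem exists_norm_apply_restrict_Ico_le [h : Fact (1 ≤ r)]
    (f : StrongDual 𝕜 (TsirelsonSpace 𝕜 r)) {δ : ℝ} (hδ : 0 < δ) :
    ∃ N₀, ∀ N ≥ N₀, ∀ M x, ‖f (restrict (Finset.Ico N M) x)‖ ≤ δ * ‖x‖ := by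
  have hr : 0 < r := one_pos.trans_le h.out
  by_contra! hcon
  -- Domination rather than equality makes `C` convex, as `t ↦ t^r` is convex. If `f` were not small
  -- far out, averaging in `C` would produce a vector `x` of norm below `ε` with `re (f x) ≥ δ`.
  let C : Set (ℕ → ℝ≥0∞) := {w | ∃ x : TsirelsonSpace 𝕜 r,
    (∀ n, ‖toSeq x n‖ₑ ^ r ≤ w n) ∧ δ ≤ RCLike.re (f x)}
  set ε : ℝ := δ / (‖f‖ + 1) with hε
  have hε0 : 0 < ε := by positivity
  obtain ⟨w, ⟨x, hxw, hfx⟩, hw⟩ : ∃ w ∈ C, tsirelsonNorm w < ENNReal.ofReal ε ^ r := by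
    refine exists_mem_tsirelsonNorm_lt ?_ ENNReal.one_ne_top (fun N₀ => ?_)
      (ENNReal.rpow_pos_of_nonneg (ENNReal.ofReal_pos.2 hε0) hr.le)
    · intro s b v hb hv
      choose! x hx hfx using hv
      refine ⟨∑ j ∈ s, ((b j : ℝ) : 𝕜) • x j, fun n => ?_, ?_⟩
      · have hb' : ∑ j ∈ s, (b j : ℝ≥0∞) = 1 := by exact_mod_cast hb
        calc ‖toSeq (∑ j ∈ s, ((b j : ℝ) : 𝕜) • x j) n‖ₑ ^ r
            ≤ (∑ j ∈ s, (b j : ℝ≥0∞) * ‖toSeq (x j) n‖ₑ) ^ r := by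
              refine ENNReal.rpow_le_rpow ?_ hr.le
              rw [map_sum, Finset.sum_apply]
              refine (enorm_sum_le _ _).trans_eq (Finset.sum_congr rfl fun j _ => ?_)
              rw [map_smul, Pi.smul_apply, enorm_smul, ← ofReal_norm, RCLike.norm_ofReal,
                abs_of_nonneg (NNReal.coe_nonneg _), ENNReal.ofReal_coe_nnreal]
          _ ≤ ∑ j ∈ s, (b j : ℝ≥0∞) * ‖toSeq (x j) n‖ₑ ^ r :=
              ENNReal.rpow_arith_mean_le_arith_mean_rpow s _ _ hb' h.out
          _ ≤ (∑ j ∈ s, b j • v j) n := by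
              rw [Finset.sum_apply]
              refine Finset.sum_le_sum fun j hj => ?_
              rw [Pi.smul_apply, ENNReal.smul_def, smul_eq_mul]
              gcongr
              exact hx j hj n
      · have hb' : ∑ j ∈ s, (b j : ℝ) = 1 := by exact_mod_cast hb
        calc δ = ∑ j ∈ s, (b j : ℝ) * δ := by rw [← Finset.sum_mul, hb', one_mul]
          _ ≤ ∑ j ∈ s, (b j : ℝ) * RCLike.re (f (x j)) := by
              refine Finset.sum_le_sum fun j hj => ?_
              exact mul_le_mul_of_nonneg_left (hfx j hj) (NNReal.coe_nonneg _)
          _ = _ := by simp [map_sum]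
    · obtain ⟨N, hN, M, x, hx⟩ := hcon N₀
      have hx0 : 0 < ‖x‖ := by
        refine norm_pos_iff.2 fun h0 => ?_
        subst h0
        simp [restrict] at hx
      obtain ⟨c, hc1, hc⟩ := RCLike.exists_norm_eq_mul_self (f (restrict (Finset.Ico N M) x))
      set u : TsirelsonSpace 𝕜 r := (((‖x‖⁻¹ : ℝ) : 𝕜) * c) • restrict (Finset.Ico N M) x with hu
      have hu1 : ‖u‖ ≤ 1 := by
        rw [hu, norm_smul, norm_mul, hc1, mul_one, RCLike.norm_ofReal,
          abs_of_nonneg (by positivity), inv_mul_le_one₀ hx0]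
        exact norm_restrict_le _ _
      refine ⟨fun n => ‖toSeq u n‖ₑ ^ r, ⟨u, fun n => le_rfl, ?_⟩, ⟨M, fun n hn => ?_⟩, ?_⟩
      · rw [hu, map_smul, smul_eq_mul, mul_assoc, ← hc, ← RCLike.ofReal_mul, RCLike.ofReal_re,
          inv_mul_eq_div, le_div_iff₀ hx0]
        exact hx.le
      · have hn' : n ∈ Set.Ico N M := by
          by_contra h0
          refine hn ?_
          dsimp only
          rw [hu, map_smul, toSeq_restrict, Pi.smul_apply, Finset.coe_Ico,
            Set.indicator_of_notMem h0, smul_zero, enorm_zero, ENNReal.zero_rpow_of_pos hr]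
        exact ⟨hN.trans hn'.1, hn'.2⟩
      · rw [tsirelsonNorm_eq_enorm_rpow]
        refine ENNReal.rpow_le_one ?_ hr.le
        rw [← ofReal_norm]
        exact ENNReal.ofReal_le_one.2 hu1
  have h1 : ‖x‖ < ε := by
    have h2 := (tsirelsonNorm_mono hxw).trans_lt hw
    rw [tsirelsonNorm_eq_enorm_rpow, ENNReal.rpow_lt_rpow_iff hr, ← ofReal_norm,
      ENNReal.ofReal_lt_ofReal_iff hε0] at h2
    exact h2
  have h3 : δ ≤ ‖f‖ * ‖x‖ := hfx.trans ((RCLike.re_le_norm _).trans (f.le_opNorm x))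
  have h4 : ‖f‖ * ‖x‖ < δ := by
    calc ‖f‖ * ‖x‖ ≤ (‖f‖ + 1) * ‖x‖ := by gcongr; linarith
      _ < (‖f‖ + 1) * ε := by gcongr
      _ = δ := mul_div_cancel₀ _ (by positivity)
  linarith

/-- The coordinate functionals form a basis of the dual. -/
theorem tendsto_sum_coord [Fact (1 ≤ r)] (f : StrongDual 𝕜 (TsirelsonSpace 𝕜 r)) :
    Tendsto (fun N => ∑ n ∈ Finset.range N, f (unitVec 𝕜 r n) • coord 𝕜 r n) atTop (𝓝 f) := by
  rw [Metric.tendsto_atTop]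
  intro ε hε
  obtain ⟨N₀, hN₀⟩ := exists_norm_apply_restrict_Ico_le f (half_pos hε)
  refine ⟨N₀, fun N hN => ?_⟩
  rw [dist_comm, dist_eq_norm]
  refine lt_of_le_of_lt (ContinuousLinearMap.opNorm_le_bound _ (half_pos hε).le fun x => ?_)
    (half_lt_self hε)
  rw [sub_apply, sum_smul_coord_apply]
  have h1 : Tendsto (fun M => ‖f (restrict (Finset.range M) x) - f (restrict (Finset.range N) x)‖)
      atTop (𝓝 ‖f x - f (restrict (Finset.range N) x)‖) :=
    (((f.continuous.tendsto _).comp (tendsto_sum_unitVec x)).sub_const _).norm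
  refine le_of_tendsto h1 ?_
  filter_upwards [eventually_ge_atTop N] with M hM
  rw [← map_sub, restrict, restrict, ← Finset.sum_Ico_eq_sub _ hM]
  exact hN₀ N hN M x

theorem sum_norm_restrict_rpow_le [h : Fact (1 ≤ r)] {N : ℕ → ℕ} (hN : StrictMono N)
    {θ : ℕ → ℕ} (hθ : StrictMono θ) (s : Finset ℕ) (hs : ∀ k ∈ s, s.card ≤ θ k)
    (x : TsirelsonSpace 𝕜 r) :
    (∑ k ∈ s, ‖restrict (Finset.Ico (N (θ k)) (N (θ k + 1))) x‖ ^ r) / 2 ≤ ‖x‖ ^ r := by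
  have hr : 0 < r := one_pos.trans_le h.out
  have h1 := sum_tsirelsonNorm_Ico_comp_le hN hθ s hs fun n => ‖toSeq x n‖ₑ ^ r
  have h2 : ∀ k, (Set.Ico (N (θ k)) (N (θ k + 1))).indicator (fun n => ‖toSeq x n‖ₑ ^ r) =
      fun n => ‖toSeq (restrict (Finset.Ico (N (θ k)) (N (θ k + 1))) x) n‖ₑ ^ r := by
    intro k
    ext n
    rw [toSeq_restrict, Finset.coe_Ico]
    by_cases hn : n ∈ Set.Ico (N (θ k)) (N (θ k + 1))
    · rw [Set.indicator_of_mem hn, Set.indicator_of_mem hn]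
    · rw [Set.indicator_of_notMem hn, Set.indicator_of_notMem hn, enorm_zero,
        ENNReal.zero_rpow_of_pos hr]
  have h3 : ∀ v : TsirelsonSpace 𝕜 r, ‖v‖ₑ ^ r = ENNReal.ofReal (‖v‖ ^ r) := fun v => by
    rw [← ofReal_norm, ENNReal.ofReal_rpow_of_nonneg (norm_nonneg _) hr.le]
  simp only [h2, tsirelsonNorm_eq_enorm_rpow, h3] at h1
  rw [← ENNReal.ofReal_sum_of_nonneg fun k _ => by positivity, ← ENNReal.ofReal_ofNat 2,
    ← ENNReal.ofReal_div_of_pos two_pos, ENNReal.ofReal_le_ofReal_iff (by positivity)] at h1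
  exact h1

/-- The upper estimate, dual to the lower `ℓ_r` estimate, for few far out blocks. -/
theorem norm_sum_smul_dual_blocks_le [h : Fact (1 ≤ r)] {N : ℕ → ℕ} (hN : StrictMono N)
    {y g : ℕ → StrongDual 𝕜 (TsirelsonSpace 𝕜 r)} {B : ℝ} (hyB : ∀ k, ‖y k‖ ≤ B)
    (hg : ∀ k x, g k x = y k (restrict (Finset.Ico (N k) (N (k + 1))) x)) {θ : ℕ → ℕ}
    (hθ : StrictMono θ) (s : Finset ℕ) (hs : ∀ k ∈ s, s.card ≤ θ k) (a : ℕ → 𝕜)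
    (ha : ∀ t : ℕ → ℝ, (∀ n, 0 ≤ t n) → ∑ n ∈ s, t n ^ r ≤ 1 → ∑ n ∈ s, ‖a n‖ * t n ≤ 1) :
    ‖∑ n ∈ s, a n • g (θ n)‖ ≤ 2 * B := by
  have hr : 0 < r := one_pos.trans_le h.out
  have hB0 : 0 ≤ B := (norm_nonneg _).trans (hyB 0)
  refine ContinuousLinearMap.opNorm_le_bound _ (by positivity) fun x => ?_
  rcases eq_or_ne x 0 with rfl | hx
  · simp
  have hx0 : 0 < ‖x‖ := norm_pos_iff.2 hx
  set R : ℕ → ℝ := fun n => ‖restrict (Finset.Ico (N (θ n)) (N (θ n + 1))) x‖ with hR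
  -- The vector `R / (2‖x‖)` lies in the `ℓ_r` unit ball because `2 ≤ 2^r`.
  have h1 : ∑ n ∈ s, ‖a n‖ * (R n / (2 * ‖x‖)) ≤ 1 := by
    refine ha _ (fun n => by positivity) ?_
    have h2 := sum_norm_restrict_rpow_le hN hθ s hs x
    calc ∑ n ∈ s, (R n / (2 * ‖x‖)) ^ r = (∑ n ∈ s, R n ^ r) / (2 ^ r * ‖x‖ ^ r) := by
          rw [Finset.sum_div]
          refine Finset.sum_congr rfl fun n _ => ?_
          rw [Real.div_rpow (norm_nonneg _) (by positivity), Real.mul_rpow two_pos.le hx0.le]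
      _ ≤ 1 := by
          rw [div_le_one (by positivity)]
          have h3 : (2 : ℝ) ≤ 2 ^ r := by
            simpa using Real.rpow_le_rpow_of_exponent_le one_le_two h.out
          calc ∑ n ∈ s, R n ^ r ≤ 2 * ‖x‖ ^ r := by linarith
            _ ≤ 2 ^ r * ‖x‖ ^ r := by gcongr
  have h4 : ∑ n ∈ s, ‖a n‖ * R n ≤ 2 * ‖x‖ := by
    have h5 : ∑ n ∈ s, ‖a n‖ * R n = (∑ n ∈ s, ‖a n‖ * (R n / (2 * ‖x‖))) * (2 * ‖x‖) := by
      rw [Finset.sum_mul]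
      refine Finset.sum_congr rfl fun n _ => ?_
      field_simp
    rw [h5]
    exact mul_le_of_le_one_left (by positivity) h1
  rw [sum_apply]
  calc ‖∑ n ∈ s, (a n • g (θ n)) x‖ ≤ ∑ n ∈ s, ‖a n‖ * R n * B := by
        refine norm_sum_le_of_le _ fun n _ => ?_
        rw [smul_apply, norm_smul, hg, mul_assoc]
        refine mul_le_mul_of_nonneg_left ?_ (norm_nonneg _)
        rw [mul_comm]
        exact (ContinuousLinearMap.le_opNorm _ _).trans
          (mul_le_mul_of_nonneg_right (hyB _) (norm_nonneg _))
    _ = (∑ n ∈ s, ‖a n‖ * R n) * B := by rw [Finset.sum_mul]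
    _ ≤ 2 * ‖x‖ * B := by gcongr
    _ = 2 * B * ‖x‖ := by ring

theorem not_isSubsymmetricBasicSequence_dual [h : Fact (1 ≤ r)]
    (x : ℕ → StrongDual 𝕜 (TsirelsonSpace 𝕜 r)) : ¬ IsSubsymmetricBasicSequence 𝕜 x := by
  intro hx
  have hr : 0 < r := one_pos.trans_le h.out
  have hsmul : ∀ (c : 𝕜) (f : StrongDual 𝕜 (TsirelsonSpace 𝕜 r)),
      ‖c • f‖ = ‖c‖ ^ (1 : ℝ) * ‖f‖ := fun c f => by rw [norm_smul, Real.rpow_one]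
  let ev : ℕ → StrongDual 𝕜 (TsirelsonSpace 𝕜 r) →ₗ[𝕜] 𝕜 := fun n =>
    { toFun := fun f => f (unitVec 𝕜 r n)
      map_add' := fun _ _ => rfl
      map_smul' := fun _ _ => rfl }
  obtain ⟨y, δ, B, N, hδ, hN, hyδ, hyB, hyθ, hblock⟩ := hx.exists_near_blocks one_pos hsmul
    (c := ev) (e := coord 𝕜 r)
    (fun n => ⟨‖unitVec 𝕜 r n‖, fun f => by
      rw [Real.rpow_one, mul_comm]
      exact f.le_opNorm _⟩) tendsto_sum_coord (η := 1 / 4) (by norm_num)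
  let I : ℕ → Finset ℕ := fun k => Finset.Ico (N k) (N (k + 1))
  let g : ℕ → StrongDual 𝕜 (TsirelsonSpace 𝕜 r) := fun k =>
    ∑ n ∈ I k, y k (unitVec 𝕜 r n) • coord 𝕜 r n
  have hg : ∀ k v, g k v = y k (restrict (I k) v) := fun k v => sum_smul_coord_apply _ _ _
  have hyg : ∀ k, ‖y k - g k‖ ≤ δ * (1 / 4) * (1 / 2) ^ k := hblock
  have hgδ : ∀ k, δ / 2 ≤ ‖g k‖ := by
    intro k
    have h1 := norm_sub_norm_le (y k) (g k)
    have h2 := hyg k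
    have h3 : δ * (1 / 4) * (1 / 2 : ℝ) ^ k ≤ δ * (1 / 4) * 1 := by
      gcongr
      exact pow_le_one₀ (by norm_num) (by norm_num)
    have h4 := hyδ k
    linarith
  -- The unit ball dual to that of `ℓ_r`, written as a polar so that `r = 1` needs no separate case.
  let D : Finset ℕ → (ℕ → 𝕜) → Prop := fun s a => ∀ t : ℕ → ℝ, (∀ n, 0 ≤ t n) →
    ∑ n ∈ s, t n ^ r ≤ 1 → ∑ n ∈ s, ‖a n‖ * t n ≤ 1
  have hD1 : ∀ s a, D s a → ∀ n ∈ s, ‖a n‖ ≤ 1 := by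
    intro s a hD n hn
    have h1 := hD (fun m => if m = n then 1 else 0) (fun m => by split_ifs <;> norm_num) ?_
    · simpa [hn] using h1
    · simp [Real.zero_rpow hr.ne', apply_ite (fun t : ℝ => t ^ r), hn]
  -- the upper estimate on a tail
  have htail : ∃ (K : ℕ) (c : ℝ), ∀ (s : Finset ℕ) (a : ℕ → 𝕜), (∀ n ∈ s, K ≤ n) →
      D s a → ‖∑ n ∈ s, a n • y n‖ ≤ c := by
    by_contra! hcon
    obtain ⟨θ, hθ, hbad⟩ := exists_strictMono_card_le
      (P := fun k s (a : ℕ → 𝕜) => D s a ∧ (k : ℝ) < ‖∑ n ∈ s, a n • y n‖)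
      fun k K => by
        obtain ⟨s, a, h1, h2, h3⟩ := hcon K k
        exact ⟨s, a, h1, h2, h3⟩
    obtain ⟨C, hC, hCθ⟩ := hyθ θ hθ
    obtain ⟨k, hk⟩ := exists_nat_ge (C * (2 * B + 2 * (δ * (1 / 4))))
    obtain ⟨s, a, ⟨hD, hay⟩, hcard⟩ := hbad k
    have h1 := norm_sum_smul_dual_blocks_le hN hyB hg hθ s hcard a hD
    have h2 := norm_sum_smul_sub_le one_pos hsmul hyg hθ (s := s) (K := 0)
      (fun _ _ => Nat.zero_le _) (hD1 s a hD)
    have h3 := norm_sub_norm_le (∑ n ∈ s, a n • y (θ n)) (∑ n ∈ s, a n • g (θ n))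
    rw [pow_zero, mul_one] at h2
    have h4 : C * ‖∑ n ∈ s, a n • y (θ n)‖ ≤ C * (2 * B + 2 * (δ * (1 / 4))) := by
      gcongr
      linarith
    have h5 := (hCθ s a).2
    linarith
  obtain ⟨K, c, hup⟩ := htail
  have hupg : ∀ (s : Finset ℕ) (a : ℕ → 𝕜), (∀ n ∈ s, K ≤ n) → D s a →
      ‖∑ n ∈ s, a n • g n‖ ≤ |c| + δ := by
    intro s a hs hD
    have h1 := hup s a hs hD
    have h2 := norm_sum_smul_sub_le one_pos hsmul hyg strictMono_id (s := s) (K := 0)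
      (fun _ _ => Nat.zero_le _) (hD1 s a hD)
    simp only [id] at h2
    have h3 := norm_sub_norm_le (∑ n ∈ s, a n • g n) (∑ n ∈ s, a n • y n)
    rw [norm_sub_rev] at h3
    rw [pow_zero, mul_one] at h2
    have h4 := le_abs_self c
    linarith
  -- vectors on which the blocks of functionals are attained
  have hu : ∀ k, ∃ u : TsirelsonSpace 𝕜 r, ‖u‖ ≤ 1 ∧ (∀ n, toSeq u n ≠ 0 →
      n ∈ Set.Ico (N k) (N (k + 1))) ∧ ∃ t : ℝ, δ / 4 ≤ t ∧ g k u = (t : 𝕜) := by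
    intro k
    obtain ⟨v, hv1, hv⟩ := (g k).exists_lt_apply_of_lt_opNorm
      (show δ / 4 < ‖g k‖ by linarith [hgδ k])
    obtain ⟨b, hb1, hb⟩ := RCLike.exists_norm_eq_mul_self (g k v)
    refine ⟨b • restrict (I k) v, ?_, fun n hn => ?_, ‖g k v‖, hv.le, ?_⟩
    · rw [norm_smul, hb1, one_mul]
      exact (norm_restrict_le _ _).trans hv1.le
    · by_contra h0
      refine hn ?_
      rw [map_smul, toSeq_restrict, Pi.smul_apply, Finset.coe_Ico,
        Set.indicator_of_notMem h0, smul_zero]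
    · have h1 : restrict (I k) (restrict (I k) v) = restrict (I k) v :=
        toSeq_injective (by rw [toSeq_restrict, toSeq_restrict, Set.indicator_indicator,
          Set.inter_self])
      rw [hb, map_smul, hg, hg, h1, smul_eq_mul]
  choose u hu1 husupp t ht hut using hu
  have hgu : ∀ j k, j ≠ k → g j (u k) = 0 := by
    intro j k hjk
    have h1 : restrict (I j) (u k) = 0 := by
      refine toSeq_injective ?_
      rw [toSeq_restrict, map_zero]
      ext n
      rw [Finset.coe_Ico, Pi.zero_apply, Set.indicator_apply_eq_zero]
      intro hj
      by_contra h0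
      have hk := husupp k n h0
      rw [Set.mem_Ico] at hj hk
      rcases lt_or_gt_of_ne hjk with h | h
      · have := hN.monotone (Nat.succ_le_of_lt h)
        simp only [Nat.succ_eq_add_one] at this
        omega
      · have := hN.monotone (Nat.succ_le_of_lt h)
        simp only [Nat.succ_eq_add_one] at this
        omega
    rw [hg, h1, map_zero]
  have hc0 : 0 < |c| + δ := by positivity
  obtain ⟨s, α, hsK, hα, hsmall⟩ := exists_norm_sum_blocks_lt hN husupp hu1 K
    (c := δ / 4 / (|c| + δ)) (by positivity)
  have hα' : ∑ n ∈ s, (α n : ℝ) = 1 := by exact_mod_cast hα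
  have hr1 : 0 ≤ 1 - 1 / r := by
    rw [sub_nonneg, div_le_one hr]
    exact h.out
  -- Complementary to the coefficients `α ^ (1/r)` of the small vector: the products are `α`, so the
  -- pairing is an average of the `t n` and at least `δ/4`. Young's inequality puts `a` in the dual
  -- ball.
  set a : ℕ → 𝕜 := fun n => (((α n : ℝ) ^ (1 - 1 / r) : ℝ) : 𝕜) with ha
  have hD : D s a := by
    intro τ hτ hτ1
    calc ∑ n ∈ s, ‖a n‖ * τ n ≤ ∑ n ∈ s, ((1 - 1 / r) * α n + 1 / r * τ n ^ r) := by
          refine Finset.sum_le_sum fun n _ => ?_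
          have h1 := Real.geom_mean_le_arith_mean2_weighted hr1 (one_div_nonneg.2 hr.le)
            (NNReal.coe_nonneg (α n)) (Real.rpow_nonneg (hτ n) r) (by ring)
          rw [← Real.rpow_mul (hτ n), mul_one_div_cancel hr.ne', Real.rpow_one] at h1
          rwa [ha, RCLike.norm_ofReal, abs_of_nonneg (by positivity)]
      _ = (1 - 1 / r) * 1 + 1 / r * ∑ n ∈ s, τ n ^ r := by
          rw [Finset.sum_add_distrib, ← Finset.mul_sum, ← Finset.mul_sum, hα']
      _ ≤ (1 - 1 / r) * 1 + 1 / r * 1 := by gcongr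
      _ = 1 := by ring
  set v := ∑ k ∈ s, (((α k : ℝ) ^ (1 / r) : ℝ) : 𝕜) • u k with hv
  have hval : (∑ n ∈ s, a n • g n) v = ((∑ n ∈ s, α n * t n : ℝ) : 𝕜) := by
    rw [sum_apply, RCLike.ofReal_sum]
    refine Finset.sum_congr rfl fun n hn => ?_
    rw [smul_apply, hv, map_sum, Finset.sum_eq_single_of_mem n hn]
    · rw [map_smul, hut, smul_eq_mul, smul_eq_mul, ha, ← mul_assoc, ← RCLike.ofReal_mul,
        ← RCLike.ofReal_mul, ← Real.rpow_add_of_nonneg (NNReal.coe_nonneg _) hr1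
        (one_div_nonneg.2 hr.le), sub_add_cancel, Real.rpow_one]
    · intro k _ hkn
      rw [map_smul, hgu n k hkn.symm, smul_zero]
  have hge : δ / 4 ≤ ‖(∑ n ∈ s, a n • g n) v‖ := by
    rw [hval, RCLike.norm_ofReal]
    refine le_trans ?_ (le_abs_self _)
    calc δ / 4 = ∑ n ∈ s, (α n : ℝ) * (δ / 4) := by rw [← Finset.sum_mul, hα', one_mul]
      _ ≤ _ := Finset.sum_le_sum fun n _ =>
        mul_le_mul_of_nonneg_left (ht n) (NNReal.coe_nonneg _)
  have hle := (ContinuousLinearMap.le_opNorm (∑ n ∈ s, a n • g n) v).trans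
    (mul_le_mul_of_nonneg_right (hupg s a hsK hD) (norm_nonneg _))
  have hlt : (|c| + δ) * ‖v‖ < (|c| + δ) * (δ / 4 / (|c| + δ)) :=
    mul_lt_mul_of_pos_left hsmall hc0
  rw [mul_div_cancel₀ _ hc0.ne'] at hlt
  linarith

end TsirelsonSpace

theorem mainTheorem7 (𝕜 : Type*) [RCLike 𝕜] (r : ℝ) [Fact (0 < r)] (s : ℝ≥0∞) [Fact (1 < s)] :
    (¬ ∃ x : ℕ → TsirelsonSpace 𝕜 r, IsSubsymmetricBasicSequence 𝕜 x) ∧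
      (¬ ∃ x : ℕ → TsirelsonDual 𝕜 s, IsSubsymmetricBasicSequence 𝕜 x) := by
  exact ⟨fun ⟨x, hx⟩ => TsirelsonSpace.not_isSubsymmetricBasicSequence x hx,
    fun ⟨x, hx⟩ => TsirelsonSpace.not_isSubsymmetricBasicSequence_dual x hx⟩
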